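/- **Definitions.** An *algebra* $L$ is a nonempty set with a collection of finitary operations; $\mathrm{Con}\,L$ is the lattice of its congruences under inclusion, $\Theta_L(x,y)$ is the least congruence identifying $x$ and $y$, and $\mathrm{Con}_c\,L$ is the $(\vee,0)$-semilattice of all finite joins of congruences $\Theta_L(x,y)$. A lattice structure on the underlying set of $L$ is *congruence-compatible* if every congruence of $L$ is also a congruence for its operations $\vee$ and $\wedge$. A $(\vee,0)$-homomorphism $\mu\colon S\to T$ of $(\vee,0)$-semilattices is *weakly distributive* if for all $x\in S$ and $y_0,y_1\in T$ with $\mu(x)\le y_0\vee y_1$ there are $x_0,x_1\in S$ with $x\le x_0\vee x_1$, $\mu(x_0)\le y_0$ and $\mu(x_1)\le y_1$. For a $(\vee,0)$-semilattice $S$ let $\mathcal{C}(S)=\{(u,v,w)\in S^3 : w\le u\vee v\}$. A finite set $x\subseteq\mathcal{C}(S)$ is *reduced* if (1) it contains exactly one triple of the form $(p,p,p)$, and we then put $\pi(x)=p$; (2) $(u,v,w)\in x$ and $(v,u,w)\in x$ imply $u=v=w$; (3) if $(u,v,w)\in x$ is different from $(\pi(x),\pi(x),\pi(x))$, then $u\not\le\pi(x)$,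 $v\not\le\pi(x)$ and $w\not\le\pi(x)$. Let $\mathcal{R}(S)$ be the set of all reduced sets, ordered by: $x\le y$ if and only if every $(u,v,w)\in x\setminus y$ satisfies $u\le\pi(y)$ or $w\le\pi(y)$. Then $\mathcal{R}(S)$ is a $(\vee,0)$-semilattice, and $s\mapsto\{(s,s,s)\}$ is a $(\vee,0)$-embedding of $S$ into $\mathcal{R}(S)$, by which $S$ is identified with a subsemilattice of $\mathcal{R}(S)$. Put $\mathcal{R}^0(S)=S$, $\mathcal{R}^{n+1}(S)=\mathcal{R}(\mathcal{R}^n(S))$ and $\mathcal{D}(S)=\bigcup_{n<\omega}\mathcal{R}^n(S)$. For a set $\Omega$ let $\mathcal{L}(\Omega)$ be the $(\vee,0)$-semilattice defined by generators $1$ and $a_0^\xi,a_1^\xi$ ($\xi\in\Omega$) and relations $a_0^\xi\vee a_1^\xi=1$ ($\xi\in\Omega$); concretely, it consists of the pairs $(X,Y)$ of disjoint finite subsets of $\Omega$, ordered by componentwise inclusion, together with a largest element $1$, where $a_0^\xi=(\{\xi\},\varnothing)$ and $a_1^\xi=(\varnothing,\{\xi\})$. Put $\mathcal{G}(\Omega)=\mathcal{D}(\mathcal{L}(\Omega))$;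 the element $1$ of $\mathcal{L}(\Omega)$ is the largest element of $\mathcal{G}(\Omega)$. **Theorem.** Let $\Omega$ be a set with $|\Omega|\ge\aleph_{\omega+1}$ and let $L$ be an algebra with a congruence-compatible lattice structure. Then there is no weakly distributive $(\vee,0)$-homomorphism $\mu\colon\mathrm{Con}_c\,L\to\mathcal{G}(\Omega)$ with $1$ in its range. -/

import Mathlib

namespace CLP

universe u v

/-! ### Algebras, congruences, finitely generated congruences -/

/-- A structure of (universal) algebra on `L`: a collection of operations from finite powers
of `L` to `L`. -/
structure AlgStr (L : Type u) where
  /-- the index set of the operations -/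
  Op : Type v
  /-- the arity of each operation -/
  arity : Op → ℕ
  /-- the operations -/
  op : ∀ o : Op, (Fin (arity o) → L) → L

/-- The equivalence relation `s` is a congruence for the map `f : Lⁿ → L`. -/
def IsCongruenceFor {L : Type u} (s : Setoid L) {n : ℕ} (f : (Fin n → L) → L) : Prop :=
  ∀ x y : Fin n → L, (∀ i, s (x i) (y i)) → s (f x) (f y)

namespace AlgStr

variable {L : Type u} (A : AlgStr.{u, v} L)

/-- The congruences of the algebra `A`. They are ordered by inclusion. -/
def Congr : Type u := {s : Setoid L // ∀ o : A.Op, IsCongruenceFor s (A.op o)}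

instance : PartialOrder A.Congr :=
  inferInstanceAs (PartialOrder {s : Setoid L // ∀ o : A.Op, IsCongruenceFor s (A.op o)})

instance : InfSet A.Congr where
  sInf S := ⟨sInf (Subtype.val '' S), by
    rintro o x y hxy _ ⟨s, hs, rfl⟩
    exact s.2 o x y fun i => hxy i _ ⟨s, hs, rfl⟩⟩

/-- The lattice of all congruences of `A`, under inclusion. -/
instance : CompleteLattice A.Congr :=
  completeLatticeOfInf A.Congr fun S => by
    constructor
    · rintro s hs x y hxy
      exact hxy _ ⟨s, hs, rfl⟩
    · rintro t ht x y hxy _ ⟨s, hs, rfl⟩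
      exact ht hs hxy

/-- The least congruence that identifies `x` with `y`. -/
def principal (x y : L) : A.Congr := sInf {s | s.1 x y}

/-- A congruence is finitely generated if it is a finite join of principal congruences. -/
def FinGen (s : A.Congr) : Prop :=
  ∃ F : Finset (L × L), s = F.sup fun p => A.principal p.1 p.2

/-- The `(∨,0)`-semilattice of all finitely generated congruences of `A`, under inclusion. -/
def Conc : Type u := {s : A.Congr // A.FinGen s}

theorem FinGen.sup {s t : A.Congr} (hs : A.FinGen s) (ht : A.FinGen t) : A.FinGen (s ⊔ t) := by
  classical
  obtain ⟨F, rfl⟩ := hs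
  obtain ⟨G, rfl⟩ := ht
  exact ⟨F ∪ G, Finset.sup_union.symm⟩

theorem FinGen.bot : A.FinGen ⊥ := ⟨∅, Finset.sup_empty.symm⟩

instance : SemilatticeSup A.Conc :=
  Subtype.semilatticeSup fun {_ _} hs ht => FinGen.sup A hs ht

instance : OrderBot A.Conc := Subtype.orderBot (FinGen.bot A)

/-- A map `f : Lⁿ → L` is congruence-compatible if every congruence of the algebra is a
congruence for `f`. -/
def CongruenceCompatible {n : ℕ} (f : (Fin n → L) → L) : Prop :=
  ∀ s : A.Congr, IsCongruenceFor s.1 f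

/-- A lattice structure on the underlying set of the algebra `A` is congruence-compatible if both
its operations are. -/
def CongruenceCompatibleLattice [Lattice L] : Prop :=
  A.CongruenceCompatible (fun x : Fin 2 → L => x 0 ⊔ x 1) ∧
    A.CongruenceCompatible (fun x : Fin 2 → L => x 0 ⊓ x 1)

end AlgStr

/-! ### Weakly distributive homomorphisms -/

/-- Weak distributivity of a `(∨,0)`-homomorphism. -/
def WeaklyDistributive {S : Type u} {T : Type v} [SemilatticeSup S] [OrderBot S]
    [SemilatticeSup T] [OrderBot T] (μ : SupBotHom S T) : Prop :=
  ∀ (x : S) (y₀ y₁ : T), μ x ≤ y₀ ⊔ y₁ → ∃ x₀ x₁ : S, x ≤ x₀ ⊔ x₁ ∧ μ x₀ ≤ y₀ ∧ μ x₁ ≤ y₁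

/-! ### The free distributive extension -/

/-- The reduced subsets of `C(S) = {(u, v, w) | w ≤ u ∨ v}`: finite sets of triples that
contain exactly one diagonal triple, `(π, π, π)`, and satisfy the two conditions `swap` and
`not_le`. -/
structure RExt (S : Type u) [SemilatticeSup S] [OrderBot S] where
  /-- the underlying finite set of triples -/
  carrier : Finset (S × S × S)
  /-- the canonical projection -/
  π : S
  le_sup : ∀ a b c, (a, b, c) ∈ carrier → c ≤ a ⊔ b
  π_mem : (π, π, π) ∈ carrier
  diag : ∀ a, (a, a, a) ∈ carrier → a = π
  swap : ∀ a b c, (a, b, c) ∈ carrier → (b, a, c) ∈ carrier → a = b ∧ b = c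
  not_le : ∀ a b c, (a, b, c) ∈ carrier → (a, b, c) ≠ (π, π, π) → ¬ a ≤ π ∧ ¬ b ≤ π ∧ ¬ c ≤ π

namespace RExt

variable {S : Type u} [SemilatticeSup S] [OrderBot S]

theorem ext_carrier {x y : RExt S} (h : x.carrier = y.carrier) : x = y := by
  have hπ : x.π = y.π := y.diag _ (h ▸ x.π_mem)
  cases x; cases y; cases h; cases hπ; rfl

/-- `x ≤ y` iff every triple `(a, b, c)` in `x \ y` has `a ≤ π(y)` or `c ≤ π(y)`. -/
instance : LE (RExt S) where
  le x y := ∀ a b c, (a, b, c) ∈ x.carrier → (a, b, c) ∉ y.carrier → a ≤ y.π ∨ c ≤ y.π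

theorem le_iff {x y : RExt S} : x ≤ y ↔
    ∀ a b c, (a, b, c) ∈ x.carrier → (a, b, c) ∈ y.carrier ∨ a ≤ y.π ∨ c ≤ y.π := by
  refine forall_congr' fun a => forall_congr' fun b => forall_congr' fun c => ?_
  tauto

theorem π_mono {x y : RExt S} (h : x ≤ y) : x.π ≤ y.π := by
  by_cases hm : (x.π, x.π, x.π) ∈ y.carrier
  · exact (y.diag _ hm).le
  · exact (h _ _ _ x.π_mem hm).elim id id

theorem subset_of_le_of_le {x y : RExt S} (h : x ≤ y) (h' : y ≤ x) : x.carrier ⊆ y.carrier := by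
  have hπ : x.π = y.π := le_antisymm (π_mono h) (π_mono h')
  rintro ⟨a, b, c⟩ ht
  by_cases hd : (a, b, c) = (x.π, x.π, x.π)
  · rw [hd, hπ]; exact y.π_mem
  · by_contra hm
    have := x.not_le _ _ _ ht hd
    have := h _ _ _ ht hm
    rw [← hπ] at this
    tauto

instance : PartialOrder (RExt S) where
  le_refl x a b c h h' := absurd h h'
  le_trans x y z hxy hyz := by
    rw [le_iff] at *
    intro a b c ht
    rcases hxy a b c ht with h | h | h
    · exact hyz a b c h
    · exact Or.inr (Or.inl (h.trans (π_mono (le_iff.2 hyz))))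
    · exact Or.inr (Or.inr (h.trans (π_mono (le_iff.2 hyz))))
  le_antisymm x y h h' :=
    ext_carrier (Finset.Subset.antisymm (subset_of_le_of_le h h') (subset_of_le_of_le h' h))

/-- The canonical image `{(x, x, x)}` of an element `x` of `S`. -/
def single (x : S) : RExt S where
  carrier := {(x, x, x)}
  π := x
  le_sup a b c h := by
    simp only [Finset.mem_singleton, Prod.mk.injEq] at h
    obtain ⟨rfl, rfl, rfl⟩ := h
    exact le_sup_left
  π_mem := Finset.mem_singleton_self _
  diag a h := by simpa using h
  swap a b c h _ := by
    simp only [Finset.mem_singleton, Prod.mk.injEq] at h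
    obtain ⟨rfl, rfl, rfl⟩ := h
    exact ⟨rfl, rfl⟩
  not_le a b c h h' := absurd (Finset.mem_singleton.1 h) h'

theorem single_le {x : S} {y : RExt S} : single x ≤ y ↔ x ≤ y.π := by
  constructor
  · exact fun h => π_mono h
  · intro h
    rw [le_iff]
    intro a b c ht
    simp only [single, Finset.mem_singleton, Prod.mk.injEq] at ht
    obtain ⟨rfl, rfl, rfl⟩ := ht
    exact Or.inr (Or.inl h)

/-- Every finite set of triples in `C(S)`, together with an element of `S`, has a least upper
bound in the poset of all reduced sets. -/
theorem exists_lub (n : ℕ) : ∀ (F : Finset (S × S × S)) (e : S), F.card = n →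
    (∀ a b c, (a, b, c) ∈ F → c ≤ a ⊔ b) →
    ∃ r : RExt S, ∀ z : RExt S, r ≤ z ↔
      e ≤ z.π ∧ ∀ a b c, (a, b, c) ∈ F → (a, b, c) ∈ z.carrier ∨ a ≤ z.π ∨ c ≤ z.π := by
  classical
  induction n using Nat.strong_induction_on with
  | _ n ih =>
  intro F e hn hF
  -- removing one triple and replacing `e` by `e'`
  have key : ∀ a b c, (a, b, c) ∈ F → ∀ e' : S,
      (∀ z : RExt S, (∀ a b c, (a, b, c) ∈ F → (a, b, c) ∈ z.carrier ∨ a ≤ z.π ∨ c ≤ z.π) →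
        e ≤ z.π → e' ≤ z.π) →
      (∀ z : RExt S, e' ≤ z.π → e ≤ z.π ∧ ((a, b, c) ∈ z.carrier ∨ a ≤ z.π ∨ c ≤ z.π)) →
      ∃ r : RExt S, ∀ z : RExt S, r ≤ z ↔
        e ≤ z.π ∧ ∀ a b c, (a, b, c) ∈ F → (a, b, c) ∈ z.carrier ∨ a ≤ z.π ∨ c ≤ z.π := by
    intro a b c ht e' h₁ h₂
    obtain ⟨r, hr⟩ := ih (F.erase (a, b, c)).card (hn ▸ Finset.card_erase_lt_of_mem ht)
      (F.erase (a, b, c)) e' rfl (fun a b c h => hF a b c (Finset.mem_of_mem_erase h))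
    refine ⟨r, fun z => (hr z).trans ⟨?_, ?_⟩⟩
    · rintro ⟨he, h⟩
      refine ⟨(h₂ z he).1, fun a' b' c' h' => ?_⟩
      by_cases heq : (a', b', c') = (a, b, c)
      · simp only [Prod.mk.injEq] at heq
        obtain ⟨rfl, rfl, rfl⟩ := heq
        exact (h₂ z he).2
      · exact h a' b' c' (Finset.mem_erase.2 ⟨heq, h'⟩)
    · rintro ⟨he, h⟩
      exact ⟨h₁ z h he, fun a' b' c' h' => h a' b' c' (Finset.mem_of_mem_erase h')⟩
  by_cases c1 : ∃ a b c, (a, b, c) ∈ F ∧ (a ≤ e ∨ c ≤ e)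
  · obtain ⟨a, b, c, ht, h⟩ := c1
    exact key a b c ht e (fun z _ he => he) fun z he =>
      ⟨he, Or.inr (h.imp (fun h => h.trans he) fun h => h.trans he)⟩
  by_cases c2 : ∃ a b c, (a, b, c) ∈ F ∧ b ≤ e
  · obtain ⟨a, b, c, ht, h⟩ := c2
    refine key a b c ht (e ⊔ c) (fun z hz he => sup_le he ?_) fun z he =>
      ⟨le_sup_left.trans he, Or.inr (Or.inr (le_sup_right.trans he))⟩
    rcases hz a b c ht with h' | h' | h'
    · by_cases hd : (a, b, c) = (z.π, z.π, z.π)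
      · simp only [Prod.mk.injEq] at hd
        exact hd.2.2.le
      · exact absurd (h.trans he) (z.not_le a b c h' hd).2.1
    · exact (hF a b c ht).trans (sup_le h' (h.trans he))
    · exact h'
  by_cases c3 : ∃ a, (a, a, a) ∈ F
  · obtain ⟨a, ht⟩ := c3
    refine key a a a ht (e ⊔ a) (fun z hz he => sup_le he ?_) fun z he =>
      ⟨le_sup_left.trans he, Or.inr (Or.inr (le_sup_right.trans he))⟩
    rcases hz a a a ht with h' | h' | h'
    · exact (z.diag a h').le
    · exact h'
    · exact h'
  by_cases c4 : ∃ a b c, (a, b, c) ∈ F ∧ (b, a, c) ∈ F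
  · obtain ⟨a, b, c, ht, ht'⟩ := c4
    refine key a b c ht (e ⊔ c) (fun z hz he => sup_le he ?_) fun z he =>
      ⟨le_sup_left.trans he, Or.inr (Or.inr (le_sup_right.trans he))⟩
    by_contra hc
    have hd : (a, b, c) ≠ (z.π, z.π, z.π) := fun h => hc (by
      simp only [Prod.mk.injEq] at h; exact h.2.2.le)
    have hd' : (b, a, c) ≠ (z.π, z.π, z.π) := fun h => hc (by
      simp only [Prod.mk.injEq] at h; exact h.2.2.le)
    have h1 := hz a b c ht
    have h2 := hz b a c ht'
    have h3 := fun h => z.not_le a b c h hd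
    have h4 := fun h => z.not_le b a c h hd'
    have h5 : ¬ ((a, b, c) ∈ z.carrier ∧ (b, a, c) ∈ z.carrier) := by
      rintro ⟨h, h'⟩
      obtain ⟨rfl, rfl⟩ := z.swap a b c h h'
      exact hc (z.diag _ h).le
    have h6 : ¬ (a ≤ z.π ∧ b ≤ z.π) := fun h => hc ((hF a b c ht).trans (sup_le h.1 h.2))
    tauto
  -- no rule applies: the set is reduced
  push Not at c1 c2 c3 c4
  refine ⟨⟨insert (e, e, e) F, e, ?_, Finset.mem_insert_self _ _, ?_, ?_, ?_⟩, fun z => ?_⟩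
  · intro a b c h
    rcases Finset.mem_insert.1 h with h | h
    · simp only [Prod.mk.injEq] at h
      obtain ⟨rfl, rfl, rfl⟩ := h
      exact le_sup_left
    · exact hF a b c h
  · intro a h
    rcases Finset.mem_insert.1 h with h | h
    · simp only [Prod.mk.injEq] at h
      exact h.1
    · exact absurd h (c3 a)
  · intro a b c h h'
    rcases Finset.mem_insert.1 h with h | h
    · simp only [Prod.mk.injEq] at h
      obtain ⟨rfl, rfl, rfl⟩ := h
      exact ⟨rfl, rfl⟩
    · rcases Finset.mem_insert.1 h' with h' | h'
      · simp only [Prod.mk.injEq] at h'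
        obtain ⟨rfl, rfl, rfl⟩ := h'
        exact ⟨rfl, rfl⟩
      · exact absurd h' (c4 a b c h)
  · intro a b c h h'
    have h := (Finset.mem_insert.1 h).resolve_left h'
    exact ⟨(c1 a b c h).1, c2 a b c h, (c1 a b c h).2⟩
  · rw [le_iff]
    constructor
    · intro h
      refine ⟨?_, fun a b c h' => h a b c (Finset.mem_insert_of_mem h')⟩
      rcases h e e e (Finset.mem_insert_self _ _) with h | h | h
      · exact (z.diag e h).le
      · exact h
      · exact h
    · rintro ⟨he, h⟩ a b c h'
      rcases Finset.mem_insert.1 h' with h' | h'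
      · simp only [Prod.mk.injEq] at h'
        obtain ⟨rfl, rfl, rfl⟩ := h'
        exact Or.inr (Or.inl he)
      · exact h a b c h'

theorem exists_sup (x y : RExt S) : ∃ r : RExt S, ∀ z, r ≤ z ↔ x ≤ z ∧ y ≤ z := by
  classical
  obtain ⟨r, hr⟩ := exists_lub _ (x.carrier ∪ y.carrier) (x.π ⊔ y.π) rfl (by
    intro a b c h
    exact (Finset.mem_union.1 h).elim (x.le_sup a b c) (y.le_sup a b c))
  refine ⟨r, fun z => (hr z).trans ⟨?_, ?_⟩⟩
  · rintro ⟨-, h⟩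
    exact ⟨le_iff.2 fun a b c h' => h a b c (Finset.mem_union_left _ h'),
      le_iff.2 fun a b c h' => h a b c (Finset.mem_union_right _ h')⟩
  · rintro ⟨h, h'⟩
    refine ⟨sup_le (π_mono h) (π_mono h'), fun a b c ht => ?_⟩
    exact (Finset.mem_union.1 ht).elim (le_iff.1 h a b c) (le_iff.1 h' a b c)

/-- The join of two reduced sets is their least upper bound. -/
noncomputable instance : SemilatticeSup (RExt S) where
  sup x y := (exists_sup x y).choose
  le_sup_left _ _ := (((exists_sup _ _).choose_spec _).1 le_rfl).1
  le_sup_right _ _ := (((exists_sup _ _).choose_spec _).1 le_rfl).2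
  sup_le _ _ z h h' := ((exists_sup _ _).choose_spec z).2 ⟨h, h'⟩

instance : OrderBot (RExt S) where
  bot := single ⊥
  bot_le _ := single_le.2 bot_le

/-- The canonical `(∨,0)`-embedding of `S` into its extension. -/
def of (S : Type u) [SemilatticeSup S] [OrderBot S] : SupBotHom S (RExt S) where
  toFun := single
  map_sup' _ _ := le_antisymm
    (single_le.2 (sup_le (single_le.1 le_sup_left) (single_le.1 le_sup_right)))
    (sup_le (single_le.2 le_sup_left) (single_le.2 le_sup_right))
  map_bot' := rfl

theorem le_single_top [OrderTop S] (x : RExt S) : x ≤ single ⊤ :=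
  fun _ _ _ _ _ => Or.inl le_top

end RExt

/-- The iterates `S, R(S), R(R(S)), …` of the construction. -/
noncomputable def tower (S : Type u) [SemilatticeSup S] [OrderBot S] : ℕ → SemilatSupCat.{u}
  | 0 => SemilatSupCat.of S
  | n + 1 => SemilatSupCat.of (RExt (tower S n))

/-- The canonical embeddings between the iterates. -/
noncomputable def towerMap (S : Type u) [SemilatticeSup S] [OrderBot S] (m n : ℕ) (h : m ≤ n) :
    SupBotHom (tower S m) (tower S n) :=
  Nat.leRecOn h (fun {k} (g : SupBotHom (tower S m) (tower S k)) =>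
    SupBotHom.comp (γ := tower S (k + 1)) (RExt.of (tower S k)) g) (SupBotHom.id _)

section tower

variable (S : Type u) [SemilatticeSup S] [OrderBot S]

theorem towerMap_self (m : ℕ) (x : tower S m) : towerMap S m m le_rfl x = x := by
  rw [towerMap, Nat.leRecOn_self]; rfl

theorem towerMap_succ (m n : ℕ) (h : m ≤ n) (x : tower S m) :
    towerMap S m (n + 1) (h.trans n.le_succ) x = RExt.of (tower S n) (towerMap S m n h x) := by
  rw [towerMap, Nat.leRecOn_succ h]; rfl

instance : DirectedSystem (fun n => tower S n) (towerMap S · · ·) where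
  map_self i x := towerMap_self S i x
  map_map k j i hij hjk x := by
    induction hjk with
    | refl => exact towerMap_self S _ _
    | step h ih =>
      rw [towerMap_succ S _ _ h, towerMap_succ S _ _ (hij.trans h), ih]

theorem le_towerMap_top [OrderTop S] (n : ℕ) (a : tower S n) :
    a ≤ towerMap S 0 n n.zero_le (⊤ : S) := by
  induction n with
  | zero => exact (le_top : (show S from a) ≤ ⊤).trans (towerMap_self S 0 (⊤ : S)).ge
  | succ n ih =>
    refine le_trans ?_ (towerMap_succ S 0 n n.zero_le (⊤ : S)).ge
    exact fun b _ _ _ _ => Or.inl (ih b)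

end tower

/-- The union `D(S)` of the increasing sequence of the iterates `Rⁿ(S)`, that is, the direct limit
of these iterates along the canonical embeddings. -/
def DExt (S : Type u) [SemilatticeSup S] [OrderBot S] : Type u :=
  DirectLimit (fun n => tower S n) (towerMap S)

namespace DExt

variable {S : Type u} [SemilatticeSup S] [OrderBot S]

/-- The canonical map from the `n`-th iterate to the union. -/
noncomputable def mk (n : ℕ) (x : tower S n) : DExt S :=
  (⟦⟨n, x⟩⟧ : DirectLimit (fun n => tower S n) (towerMap S))

variable (S) in
/-- The canonical embedding of `S` into `D(S)`. -/
noncomputable def emb (x : S) : DExt S := mk 0 (x : tower S 0)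

theorem emb_eq (n : ℕ) (x : S) :
    emb S x = mk n (towerMap S 0 n n.zero_le (x : tower S 0)) :=
  (DirectLimit.mk_apply (F := fun n => tower S n) (f := towerMap S) 0 n x n.zero_le).symm

theorem exists_mk₃ (x y z : DExt S) :
    ∃ n a b c, x = mk n a ∧ y = mk n b ∧ z = mk n c :=
  DirectLimit.exists_eq_mk₃ (towerMap S) x y z

noncomputable instance : Max (DExt S) where
  max := DirectLimit.map₂ (towerMap S) (towerMap S) (towerMap S) (fun _ x y => x ⊔ y)
    fun i j h x y => map_sup (towerMap S i j h) x y

theorem mk_sup (n : ℕ) (x y : tower S n) : mk n (x ⊔ y) = mk n x ⊔ mk n y :=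
  (DirectLimit.map₂_def (towerMap S) (towerMap S) (towerMap S) (fun _ x y => x ⊔ y)
    (fun i j h x y => map_sup (towerMap S i j h) x y) n x y).symm

/-- The order is the one of the join: `x ≤ y` iff `x ∨ y = y`. -/
noncomputable instance : SemilatticeSup (DExt S) :=
  SemilatticeSup.mk'
    (fun x y => by
      obtain ⟨n, a, b, _, rfl, rfl, -⟩ := exists_mk₃ x y y
      rw [← mk_sup, ← mk_sup, sup_comm])
    (fun x y z => by
      obtain ⟨n, a, b, c, rfl, rfl, rfl⟩ := exists_mk₃ x y z
      simp only [← mk_sup, sup_assoc])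
    (fun x => by
      obtain ⟨n, a, _, _, rfl, -, -⟩ := exists_mk₃ x x x
      rw [← mk_sup, sup_idem])

noncomputable instance : OrderBot (DExt S) where
  bot := emb S ⊥
  bot_le x := by
    obtain ⟨n, a, _, _, rfl, -, -⟩ := exists_mk₃ x x x
    rw [emb_eq n]
    refine (mk_sup n _ a).symm.trans (congrArg (mk n) ?_)
    exact sup_eq_right.2 ((map_bot (towerMap S 0 n n.zero_le)).le.trans bot_le)

/-- The largest element of `S`, if there is one, is the largest element of `D(S)`. -/
noncomputable instance [OrderTop S] : OrderTop (DExt S) where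
  top := emb S ⊤
  le_top x := by
    obtain ⟨n, a, _, _, rfl, -, -⟩ := exists_mk₃ x x x
    rw [emb_eq n]
    exact (mk_sup n a _).symm.trans (congrArg (mk n) (sup_eq_right.2 (le_towerMap_top S n a)))

end DExt

/-! ### The semilattices `L(Ω)` and `G(Ω)` -/

/-- The pairs of finite disjoint subsets of `Ω`, ordered componentwise by inclusion. -/
def DisjPair (Ω : Type u) : Type u := {p : Finset Ω × Finset Ω // Disjoint p.1 p.2}

/-- The pair `(X, Y)` as an element of `DisjPair Ω`. -/
def DisjPair.mk {Ω : Type u} (X Y : Finset Ω) (h : Disjoint X Y) : DisjPair Ω := ⟨(X, Y), h⟩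

instance (Ω : Type u) : PartialOrder (DisjPair Ω) :=
  inferInstanceAs (PartialOrder {p : Finset Ω × Finset Ω // Disjoint p.1 p.2})

instance (Ω : Type u) : OrderBot (DisjPair Ω) where
  bot := ⟨(∅, ∅), Finset.disjoint_empty_left _⟩
  bot_le _ := ⟨Finset.empty_subset _, Finset.empty_subset _⟩

/-- The `(∨,0)`-semilattice `L(Ω)` defined by generators `1`, `a₀(ξ)`, `a₁(ξ)` (for `ξ ∈ Ω`) and
relations `a₀(ξ) ∨ a₁(ξ) = 1`, in its concrete representation: its elements are the
pairs `(X, Y)` of finite disjoint subsets of `Ω`, together with a largest element `1`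
(which stands for `(Ω, Ω)`). Here `a₀(ξ) = ({ξ}, ∅)` and `a₁(ξ) = (∅, {ξ})`. -/
def LSemi (Ω : Type u) : Type u := WithTop (DisjPair Ω)

namespace LSemi

variable {Ω : Type u}

instance : PartialOrder (LSemi Ω) := inferInstanceAs (PartialOrder (WithTop (DisjPair Ω)))
instance : OrderBot (LSemi Ω) := inferInstanceAs (OrderBot (WithTop (DisjPair Ω)))
instance : OrderTop (LSemi Ω) := inferInstanceAs (OrderTop (WithTop (DisjPair Ω)))

open Classical in
/-- The join: componentwise union if this is a disjoint pair, and `1` otherwise. -/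
noncomputable def join : WithTop (DisjPair Ω) → WithTop (DisjPair Ω) → WithTop (DisjPair Ω)
  | WithTop.some p, WithTop.some q =>
    if h : Disjoint (p.1.1 ∪ q.1.1) (p.1.2 ∪ q.1.2) then
      WithTop.some (DisjPair.mk (p.1.1 ∪ q.1.1) (p.1.2 ∪ q.1.2) h) else ⊤
  | _, _ => ⊤

theorem join_le_iff (x y z : WithTop (DisjPair Ω)) : join x y ≤ z ↔ x ≤ z ∧ y ≤ z := by
  classical
  induction z using WithTop.recTopCoe with
  | top => simp
  | coe r =>
  induction x using WithTop.recTopCoe with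
  | top => simp [join]
  | coe p =>
  induction y using WithTop.recTopCoe with
  | top => simp [join]
  | coe q =>
  have hle : ∀ s t : DisjPair Ω, s ≤ t ↔ s.1.1 ⊆ t.1.1 ∧ s.1.2 ⊆ t.1.2 := fun _ _ => Iff.rfl
  change (if h : Disjoint (p.1.1 ∪ q.1.1) (p.1.2 ∪ q.1.2) then
      ((DisjPair.mk (p.1.1 ∪ q.1.1) (p.1.2 ∪ q.1.2) h : DisjPair Ω) : WithTop (DisjPair Ω)) else ⊤) ≤ _ ↔ _
  rw [WithTop.coe_le_coe, WithTop.coe_le_coe, hle, hle]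
  split_ifs with h
  · rw [WithTop.coe_le_coe, hle]
    simp only [DisjPair.mk, Finset.union_subset_iff]
    tauto
  · refine ⟨fun h' => absurd h' (by simp), fun h' => absurd ?_ h⟩
    exact Disjoint.mono (Finset.union_subset h'.1.1 h'.2.1) (Finset.union_subset h'.1.2 h'.2.2) r.2

noncomputable instance : SemilatticeSup (LSemi Ω) where
  sup x y := join x y
  le_sup_left x y := ((join_le_iff x y _).1 le_rfl).1
  le_sup_right x y := ((join_le_iff x y _).1 le_rfl).2
  sup_le x y z h h' := (join_le_iff x y z).2 ⟨h, h'⟩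

end LSemi

/-- The distributive `(∨,0,1)`-semilattice `G(Ω) = D(L(Ω))`. -/
abbrev GSemi (Ω : Type u) : Type u := DExt (LSemi Ω)

end CLP

/-!
The proof rests on two lemmas, one about the semilattice `G(Ω)` and one about congruences.

*Evaporation* (`CLP.GSemi.eq_bot_of_le_sup`). Let `z ≤ x ∨ y` in `G(Ω)`, where `x` is below
`a₀(δ)` and below a join of generators indexed by a finite set `X₀`, the element `y` is below
`a₁(δ)` and below a join of generators indexed by `X₁`, and the supports of `x`, `y`, `z` avoid
`X₁`, `X₀`, `{δ}`, respectively. Then `z = 0`. To see this one looks for an ideal of `G(Ω)` that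
contains `x` and `y` but no nonzero element with support in `{δ}ᶜ`. The ideals `↓x`, `↓y`, `{0}` of
the semilattices `G(X₁ᶜ)`, `G(X₀ᶜ)`, `G({δ}ᶜ)` agree (they are zero) on pairwise intersections, and
such a compatible family of ideals always extends to an ideal of `G(Ω)`: this can be done one step
`S ⊆ R(S)` at a time (`CLP.RExt.exists_ideal`), since `R(S)` is generated over `S` by elements
`⋈(a, b, c)`, for `c ≤ a ∨ b`, subject to the relations `⋈(a, b, c) ≤ a` and
`⋈(a, b, c) ∨ ⋈(b, a, c) = c` only, so that membership of a new generator in the ideal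
is restricted by a single other generator, with the same entries.

*Erosion* (`CLP.theta_le_erosion_sup`, `CLP.map_erosion_le`, `CLP.erosion_le_theta`). If
`z 0, …, z n` is a sequence in `L`, then joining it with `x` at the steps of even index and with
`y` at those of odd index gives two congruences that together identify `z 0 ∨ x ∨ y` with
`z n ∨ x ∨ y`; each of them is small, both because it is contained in the join of
the steps of one parity, and because it collapses to zero wherever all `z i` are below `x`
(respectively `y`).

Suppose that `μ` is weakly distributive and that its range contains `1`. Then `μ Θ(a, b) = 1`
for some `a ≤ b` in `L`. For each `ξ ∈ Ω`, weak distributivity at `1 = a₀(ξ) ∨ a₁(ξ)` yields a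
sequence from `a` to `b` whose steps have images alternately below `a₀(ξ)` and
`a₁(ξ)`. As `|Ω| > ℵ_ω`, there are more than `ℵ_ω` many `ξ` for which the sequence has the same
length `n`, so that Kuratowski's free set theorem provides `2 ^ n + 1` of them that are independent
as to the supports of all the elements that matter. The two lemmas then give
`μ Θ(⋁_{ξ ∈ X} z_k^ξ, b) = 0` for all sets `X` of `2 ^ (n - k)` of these indices, by downward
induction on `k` (`CLP.map_theta_eq_bot`): split `X` into halves `X₀`, `X₁`, take a further index
`δ`, and erode its sequence along the joins over `X₀` and `X₁`. For `k = 0` this says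
`μ Θ(a, b) = 0`, a contradiction.
-/

namespace CLP

universe u v w

namespace RExt

variable {S : Type u} [SemilatticeSup S] [OrderBot S]

/-! ### Ideals of the free distributive extension -/

theorem exists_bow (a b c : S) (h : c ≤ a ⊔ b) :
    ∃ r : RExt S, (∀ V : Set S, ⊥ ∈ V → a ∈ V → b ∈ V → c ∈ V →
        ∀ p q s, (p, q, s) ∈ r.carrier → p ∈ V ∧ q ∈ V ∧ s ∈ V) ∧
      ∀ z : RExt S, r ≤ z ↔ (a, b, c) ∈ z.carrier ∨ a ≤ z.π ∨ c ≤ z.π := by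
  classical
  have hsingle : ∀ e : S, ∀ V : Set S, e ∈ V →
      ∀ p q s, (p, q, s) ∈ (single e).carrier → p ∈ V ∧ q ∈ V ∧ s ∈ V := by
    intro e V he p q s h
    simp only [single, Finset.mem_singleton, Prod.mk.injEq] at h
    obtain ⟨rfl, rfl, rfl⟩ := h
    exact ⟨he, he, he⟩
  by_cases h1 : a = ⊥ ∨ c = ⊥
  · refine ⟨single ⊥, fun V hV _ _ _ => hsingle ⊥ V hV, fun z => ?_⟩
    rw [single_le]
    rcases h1 with rfl | rfl <;> simp
  by_cases h2 : b = ⊥ ∨ a = b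
  · have hca : c ≤ a := by rcases h2 with rfl | rfl <;> simpa using h
    refine ⟨single c, fun V _ _ _ hc => hsingle c V hc, fun z => ?_⟩
    rw [single_le]
    refine ⟨fun h => Or.inr (Or.inr h), ?_⟩
    rintro (h | h | h)
    · by_cases hd : (a, b, c) = (z.π, z.π, z.π)
      · simp only [Prod.mk.injEq] at hd
        exact hd.2.2.le
      · rcases h2 with rfl | rfl
        · exact absurd bot_le (z.not_le _ _ _ h hd).2.1
        · obtain ⟨-, rfl⟩ := z.swap _ _ _ h h
          exact (z.diag _ h).le
    · exact hca.trans h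
    · exact h
  push Not at h1 h2
  have hF : ∀ p q s : S, (p, q, s) ∈ ({(⊥, ⊥, ⊥), (a, b, c)} : Finset (S × S × S)) ↔
      (p = ⊥ ∧ q = ⊥ ∧ s = ⊥) ∨ (p = a ∧ q = b ∧ s = c) := by
    intro p q s
    simp only [Finset.mem_insert, Finset.mem_singleton, Prod.mk.injEq]
  refine ⟨⟨{(⊥, ⊥, ⊥), (a, b, c)}, ⊥, ?_, by simp, ?_, ?_, ?_⟩, ?_, fun z => ?_⟩
  · intro p q s hp
    rcases (hF p q s).1 hp with ⟨rfl, rfl, rfl⟩ | ⟨rfl, rfl, rfl⟩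
    · exact bot_le
    · exact h
  · intro p hp
    rcases (hF p p p).1 hp with ⟨rfl, -, -⟩ | ⟨rfl, h', -⟩
    · rfl
    · exact absurd h' h2.2
  · intro p q s hp hq
    rcases (hF p q s).1 hp with ⟨rfl, rfl, rfl⟩ | ⟨rfl, rfl, rfl⟩
    · exact ⟨rfl, rfl⟩
    · rcases (hF q p s).1 hq with ⟨rfl, rfl, rfl⟩ | ⟨h', -, -⟩
      · exact ⟨rfl, rfl⟩
      · exact absurd h'.symm h2.2
  · intro p q s hp hne
    rcases (hF p q s).1 hp with ⟨rfl, rfl, rfl⟩ | ⟨rfl, rfl, rfl⟩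
    · exact absurd rfl hne
    · simp only [le_bot_iff]
      exact ⟨h1.1, h2.1, h1.2⟩
  · intro V hV ha hb hc p q s hp
    rcases (hF p q s).1 hp with ⟨rfl, rfl, rfl⟩ | ⟨rfl, rfl, rfl⟩
    · exact ⟨hV, hV, hV⟩
    · exact ⟨ha, hb, hc⟩
  · rw [le_iff]
    constructor
    · exact fun h' => h' a b c ((hF a b c).2 (Or.inr ⟨rfl, rfl, rfl⟩))
    · intro h' p q s hp
      rcases (hF p q s).1 hp with ⟨rfl, rfl, rfl⟩ | ⟨rfl, rfl, rfl⟩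
      · exact Or.inr (Or.inl bot_le)
      · exact h'

/-- The generator `⋈(a, b, c)` of the extension, for `c ≤ a ∨ b`: the part of `c` that lies
below `a`, where the remaining part `⋈(b, a, c)` lies below `b`. -/
noncomputable def bow (a b c : S) (h : c ≤ a ⊔ b) : RExt S := (exists_bow a b c h).choose

theorem bow_le_iff {a b c : S} {h : c ≤ a ⊔ b} {z : RExt S} :
    bow a b c h ≤ z ↔ (a, b, c) ∈ z.carrier ∨ a ≤ z.π ∨ c ≤ z.π :=
  (exists_bow a b c h).choose_spec.2 z

theorem bow_le_left {a b c : S} (h : c ≤ a ⊔ b) : bow a b c h ≤ single a :=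
  bow_le_iff.2 (Or.inr (Or.inl le_rfl))

theorem bow_le_right {a b c : S} (h : c ≤ a ⊔ b) : bow a b c h ≤ single c :=
  bow_le_iff.2 (Or.inr (Or.inr le_rfl))

theorem single_le_bow_sup {a b c : S} (h : c ≤ a ⊔ b) :
    single c ≤ bow a b c h ⊔ single b := by
  have h1 : bow a b c h ≤ bow a b c h ⊔ single b := le_sup_left
  have h2 : single b ≤ bow a b c h ⊔ single b := le_sup_right
  generalize bow a b c h ⊔ single b = z at h1 h2 ⊢
  rw [bow_le_iff] at h1
  rw [single_le] at h2 ⊢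
  rcases h1 with h1 | h1 | h1
  · by_cases hd : (a, b, c) = (z.π, z.π, z.π)
    · simp only [Prod.mk.injEq] at hd
      exact hd.2.2.le
    · exact absurd h2 (z.not_le _ _ _ h1 hd).2.1
  · exact h.trans (sup_le h1 h2)
  · exact h1

theorem single_le_bow_sup_bow {a b c : S} (h : c ≤ a ⊔ b) (h' : c ≤ b ⊔ a) :
    single c ≤ bow a b c h ⊔ bow b a c h' := by
  have h1 : bow a b c h ≤ bow a b c h ⊔ bow b a c h' := le_sup_left
  have h2 : bow b a c h' ≤ bow a b c h ⊔ bow b a c h' := le_sup_right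
  generalize bow a b c h ⊔ bow b a c h' = z at h1 h2 ⊢
  by_cases ha : a ≤ z.π
  · exact (single_le_bow_sup h').trans (sup_le h2 (single_le.2 ha))
  by_cases hb : b ≤ z.π
  · exact (single_le_bow_sup h).trans (sup_le h1 (single_le.2 hb))
  rw [bow_le_iff] at h1 h2
  rw [single_le]
  rcases h1 with h1 | h1 | h1
  · rcases h2 with h2 | h2 | h2
    · obtain ⟨rfl, rfl⟩ := z.swap _ _ _ h1 h2
      exact (z.diag _ h1).le
    · exact absurd h2 hb
    · exact h2
  · exact absurd h1 ha
  · exact h1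

theorem single_le_bow_self {a : S} (h : a ≤ a ⊔ a) : single a ≤ bow a a a h :=
  (single_le_bow_sup_bow h h).trans (sup_idem _).le

/-- The reduced sets all of whose triples have their entries in `V`. For a
subsemilattice `V` of `S`, this is the copy of the extension of `V`. -/
def supportedOn (V : Set S) : Set (RExt S) :=
  {x | ∀ a b c, (a, b, c) ∈ x.carrier → a ∈ V ∧ b ∈ V ∧ c ∈ V}

theorem single_mem_supportedOn {V : Set S} {s : S} : single s ∈ supportedOn V ↔ s ∈ V := by
  constructor
  · exact fun h => (h s s s (Finset.mem_singleton_self _)).1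
  · intro hs a b c h
    simp only [single, Finset.mem_singleton, Prod.mk.injEq] at h
    obtain ⟨rfl, rfl, rfl⟩ := h
    exact ⟨hs, hs, hs⟩

theorem bow_mem_supportedOn {V : Set S} (hV : ⊥ ∈ V) {a b c : S} (h : c ≤ a ⊔ b) (ha : a ∈ V)
    (hb : b ∈ V) (hc : c ∈ V) : bow a b c h ∈ supportedOn V :=
  (exists_bow a b c h).choose_spec.1 V hV ha hb hc

theorem le_iff_bow_le {x z : RExt S} :
    x ≤ z ↔ ∀ a b c (h : (a, b, c) ∈ x.carrier), bow a b c (x.le_sup a b c h) ≤ z := by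
  rw [le_iff]
  exact forall_congr' fun a => forall_congr' fun b => forall_congr' fun c =>
    forall_congr' fun h => bow_le_iff.symm

/-- A criterion for a class of triples to carry an upper bound of any finite set of its members:
the reduction rules have to preserve it. Here `I` says which elements of `S`
may be absorbed by the canonical projection. -/
theorem exists_upper_bound (I : Order.Ideal S) (P : S → S → S → Prop)
    (hIP : ∀ a ∈ I, P a a a)
    (h₁ : ∀ a b c, c ≤ a ⊔ b → P a b c → b ∈ I → c ∈ I)
    (h₂ : ∀ a, P a a a → a ∈ I)
    (h₃ : ∀ a b c, c ≤ a ⊔ b → P a b c → P b a c → c ∈ I)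
    (n : ℕ) : ∀ (F : Finset (S × S × S)) (e : S), F.card = n → e ∈ I →
    (∀ a b c, (a, b, c) ∈ F → c ≤ a ⊔ b ∧ P a b c) →
    ∃ r : RExt S, (∀ a b c, (a, b, c) ∈ r.carrier → P a b c) ∧ e ≤ r.π ∧
      ∀ a b c, (a, b, c) ∈ F → (a, b, c) ∈ r.carrier ∨ a ≤ r.π ∨ c ≤ r.π := by
  classical
  induction n using Nat.strong_induction_on with
  | _ n ih =>
  intro F e hn he hF
  have key : ∀ a b c, (a, b, c) ∈ F → ∀ e' ∈ I, e ≤ e' → (a ≤ e' ∨ c ≤ e') →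
      ∃ r : RExt S, (∀ a b c, (a, b, c) ∈ r.carrier → P a b c) ∧ e ≤ r.π ∧
        ∀ a b c, (a, b, c) ∈ F → (a, b, c) ∈ r.carrier ∨ a ≤ r.π ∨ c ≤ r.π := by
    intro a b c ht e' he' hee' hac
    obtain ⟨r, hr, hπ, hr'⟩ := ih (F.erase (a, b, c)).card
      (hn ▸ Finset.card_erase_lt_of_mem ht) (F.erase (a, b, c)) e' rfl he'
      (fun a b c h => hF a b c (Finset.mem_of_mem_erase h))
    refine ⟨r, hr, hee'.trans hπ, fun p q s hp => ?_⟩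
    by_cases heq : (p, q, s) = (a, b, c)
    · simp only [Prod.mk.injEq] at heq
      obtain ⟨rfl, rfl, rfl⟩ := heq
      exact Or.inr (hac.imp (fun h => h.trans hπ) fun h => h.trans hπ)
    · exact hr' p q s (Finset.mem_erase.2 ⟨heq, hp⟩)
  by_cases c1 : ∃ a b c, (a, b, c) ∈ F ∧ (a ≤ e ∨ c ≤ e)
  · obtain ⟨a, b, c, ht, h⟩ := c1
    exact key a b c ht e he le_rfl h
  by_cases c2 : ∃ a b c, (a, b, c) ∈ F ∧ c ∈ I
  · obtain ⟨a, b, c, ht, h⟩ := c2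
    exact key a b c ht (e ⊔ c) (Order.Ideal.sup_mem he h) le_sup_left (Or.inr le_sup_right)
  -- no triple of `F` can be absorbed, so `F` is reduced up to its diagonal triple
  push Not at c1 c2
  have c3 : ∀ a, (a, a, a) ∉ F := fun a ha => c2 a a a ha (h₂ a (hF a a a ha).2)
  refine ⟨⟨insert (e, e, e) F, e, ?_, Finset.mem_insert_self _ _, ?_, ?_, ?_⟩, ?_, le_rfl,
    fun a b c h => Or.inl (Finset.mem_insert_of_mem h)⟩
  · intro a b c h
    rcases Finset.mem_insert.1 h with h | h
    · simp only [Prod.mk.injEq] at h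
      obtain ⟨rfl, rfl, rfl⟩ := h
      exact le_sup_left
    · exact (hF a b c h).1
  · intro a h
    rcases Finset.mem_insert.1 h with h | h
    · simp only [Prod.mk.injEq] at h
      exact h.1
    · exact absurd h (c3 a)
  · intro a b c h h'
    rcases Finset.mem_insert.1 h with h | h
    · simp only [Prod.mk.injEq] at h
      obtain ⟨rfl, rfl, rfl⟩ := h
      exact ⟨rfl, rfl⟩
    · rcases Finset.mem_insert.1 h' with h' | h'
      · simp only [Prod.mk.injEq] at h'
        obtain ⟨rfl, rfl, rfl⟩ := h'
        exact ⟨rfl, rfl⟩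
      · exact absurd (h₃ a b c (hF a b c h).1 (hF a b c h).2 (hF b a c h').2) (c2 a b c h)
  · intro a b c h h'
    have h := (Finset.mem_insert.1 h).resolve_left h'
    refine ⟨(c1 a b c h).1, fun hb => ?_, (c1 a b c h).2⟩
    exact c2 a b c h (h₁ a b c (hF a b c h).1 (hF a b c h).2 (I.lower hb he))
  · intro a b c h
    rcases Finset.mem_insert.1 h with h | h
    · simp only [Prod.mk.injEq] at h
      obtain ⟨rfl, rfl, rfl⟩ := h
      exact hIP _ he
    · exact (hF a b c h).2

/-- Amalgamation of ideals over one step of the construction. On each set `supportedOn (V i)` an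
ideal is prescribed as the trace of a principal ideal of some semilattice `T`. If these agree pairwise,
and also agree with an ideal `I` of `S`, then they are all induced by one ideal of the extension.
The freedom in choosing the ideal of the extension is that, for each triple `(a, b, c)` with
`a, b, c ∉ I`, one may still decide whether `⋈(a, b, c)` belongs to it; these decisions interact
only through the pairs `⋈(a, b, c)`, `⋈(b, a, c)`, whose entries lie in the same sets `V i`. -/
theorem exists_ideal {T : Type v} [SemilatticeSup T] {ι : Type w} (φ : RExt S → T)
    (hφ : ∀ x y, φ (x ⊔ y) = φ x ⊔ φ y) (V : ι → Set S) (hV : ∀ i, ⊥ ∈ V i) (t : ι → T)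
    (hVt : ∀ i j, ∀ x ∈ supportedOn (V i), x ∈ supportedOn (V j) → φ x ≤ t i → φ x ≤ t j)
    (I : Order.Ideal S) (hI : ∀ i, ∀ s ∈ V i, s ∈ I ↔ φ (single s) ≤ t i) :
    ∃ J : Order.Ideal (RExt S), (∀ i, ∀ x ∈ supportedOn (V i), x ∈ J ↔ φ x ≤ t i) ∧
      ∀ s ∈ I, single s ∈ J := by
  classical
  have hmono : Monotone φ := fun x y h => by
    rw [← sup_eq_right.2 h, hφ]; exact le_sup_left
  let P : S → S → S → Prop := fun a b c => a ∈ I ∨ c ∈ I ∨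
    ∃ (i : ι) (h : c ≤ a ⊔ b), a ∈ V i ∧ b ∈ V i ∧ c ∈ V i ∧ φ (bow a b c h) ≤ t i
  have hP₁ : ∀ a b c, c ≤ a ⊔ b → P a b c → b ∈ I → c ∈ I := by
    rintro a b c h (ha | hc | ⟨i, h, ha, hb, hc, hi⟩) hbI
    · exact I.lower h (Order.Ideal.sup_mem ha hbI)
    · exact hc
    · refine (hI i c hc).2 ((hmono (single_le_bow_sup h)).trans ?_)
      rw [hφ]
      exact sup_le hi ((hI i b hb).1 hbI)
  have hP₂ : ∀ a, P a a a → a ∈ I := by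
    rintro a (ha | ha | ⟨i, h, ha, -, -, hi⟩)
    · exact ha
    · exact ha
    · exact (hI i a ha).2 ((hmono (single_le_bow_self h)).trans hi)
  have hP₃ : ∀ a b c, c ≤ a ⊔ b → P a b c → P b a c → c ∈ I := by
    intro a b c h h₁ h₂
    have h' : c ≤ b ⊔ a := h.trans (sup_comm a b).le
    rcases h₁ with ha | hc | ⟨i, h, ha, hb, hc, hi⟩
    · exact hP₁ b a c h' h₂ ha
    · exact hc
    rcases h₂ with hb' | hc' | ⟨j, h', hb', ha', hc', hj⟩
    · exact hP₁ a b c h (Or.inr (Or.inr ⟨i, h, ha, hb, hc, hi⟩)) hb'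
    · exact hc'
    refine (hI j c hc').2 ((hmono (single_le_bow_sup_bow h h')).trans ?_)
    rw [hφ]
    exact sup_le (hVt i j _ (bow_mem_supportedOn (hV i) h ha hb hc)
      (bow_mem_supportedOn (hV j) h ha' hb' hc')
      hi) hj
  have hπ : ∀ x : RExt S, (∀ a b c, (a, b, c) ∈ x.carrier → P a b c) → x.π ∈ I :=
    fun x hx => hP₂ _ (hx _ _ _ x.π_mem)
  let J : Order.Ideal (RExt S) :=
    { carrier := {x | ∀ a b c, (a, b, c) ∈ x.carrier → P a b c}
      lower' := by
        intro y x hxy hy a b c h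
        rcases le_iff.1 hxy a b c h with h | h | h
        · exact hy a b c h
        · exact Or.inl (I.lower h (hπ y hy))
        · exact Or.inr (Or.inl (I.lower h (hπ y hy)))
      nonempty' := by
        refine ⟨single ⊥, fun a b c h => ?_⟩
        simp only [single, Finset.mem_singleton, Prod.mk.injEq] at h
        exact Or.inl (h.1 ▸ Order.Ideal.bot_mem I)
      directed' := by
        intro x hx y hy
        obtain ⟨r, hr, -, hF⟩ := exists_upper_bound I P (fun a ha => Or.inl ha) hP₁ hP₂ hP₃ _
          (x.carrier ∪ y.carrier) (x.π ⊔ y.π) rfl (Order.Ideal.sup_mem (hπ x hx) (hπ y hy))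
          (fun a b c h => (Finset.mem_union.1 h).elim
            (fun h => ⟨x.le_sup a b c h, hx a b c h⟩) (fun h => ⟨y.le_sup a b c h, hy a b c h⟩))
        exact ⟨r, hr, le_iff.2 fun a b c h => hF a b c (Finset.mem_union_left _ h),
          le_iff.2 fun a b c h => hF a b c (Finset.mem_union_right _ h)⟩ }
  have hmem : ∀ x, x ∈ J ↔ ∀ a b c, (a, b, c) ∈ x.carrier → P a b c := fun x => Iff.rfl
  refine ⟨J, fun i x hx => ⟨fun hxJ => ?_, fun hxt => ?_⟩, fun s hs => ?_⟩
  · -- it suffices to bound all generators below `x`, among them `π x`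
    have hbow : ∀ a b c (h : (a, b, c) ∈ x.carrier), φ (bow a b c (x.le_sup a b c h)) ≤ t i := by
      intro a b c h
      obtain ⟨ha, hb, hc⟩ := hx a b c h
      rcases hxJ a b c h with h' | h' | ⟨j, h', ha', hb', hc', hj⟩
      · exact (hmono (bow_le_left _)).trans ((hI i a ha).1 h')
      · exact (hmono (bow_le_right _)).trans ((hI i c hc).1 h')
      · exact hVt j i _ (bow_mem_supportedOn (hV j) _ ha' hb' hc')
          (bow_mem_supportedOn (hV i) _ ha hb hc) hj
    have hfin : ∀ F ⊆ x.carrier, ∃ y, φ y ≤ t i ∧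
        ∀ a b c (h : (a, b, c) ∈ x.carrier), (a, b, c) ∈ F → bow a b c (x.le_sup a b c h) ≤ y := by
      intro F
      induction F using Finset.induction_on with
      | empty => exact fun _ => ⟨single ⊥, (hI i ⊥ (hV i)).1 (Order.Ideal.bot_mem I), by simp⟩
      | insert p F _ ih =>
        intro hF
        obtain ⟨y, hy, hFy⟩ := ih ((Finset.subset_insert p F).trans hF)
        obtain ⟨p, q, s⟩ := p
        have hp := hF (Finset.mem_insert_self _ F)
        refine ⟨bow p q s (x.le_sup p q s hp) ⊔ y, ?_, fun a b c h h' => ?_⟩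
        · rw [hφ]
          exact sup_le (hbow p q s hp) hy
        · rcases Finset.mem_insert.1 h' with h' | h'
          · simp only [Prod.mk.injEq] at h'
            obtain ⟨rfl, rfl, rfl⟩ := h'
            exact le_sup_left
          · exact (hFy a b c h h').trans le_sup_right
    obtain ⟨y, hy, hxy⟩ := hfin x.carrier subset_rfl
    exact (hmono (le_iff_bow_le.2 fun a b c h => hxy a b c h h)).trans hy
  · intro a b c h
    obtain ⟨ha, hb, hc⟩ := hx a b c h
    exact Or.inr (Or.inr ⟨i, x.le_sup a b c h, ha, hb, hc,
      (hmono (le_iff_bow_le.1 le_rfl a b c h)).trans hxt⟩)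
  · intro a b c h
    simp only [single, Finset.mem_singleton, Prod.mk.injEq] at h
    exact Or.inl (h.1 ▸ hs)

end RExt

/-! ### Supports in the iterated extensions -/

section tower

variable {S : Type u} [SemilatticeSup S] [OrderBot S]

/-- The elements of the `n`-th iterate that are built from elements of `V` only. -/
def towerOn (V : Set S) : ∀ n, Set (tower S n)
  | 0 => V
  | n + 1 => RExt.supportedOn (towerOn V n)

theorem towerOn_mono {V W : Set S} (h : V ⊆ W) : ∀ n, towerOn V n ⊆ towerOn W n
  | 0 => h
  | n + 1 => fun _ hx a b c hm =>
    ⟨towerOn_mono h n (hx a b c hm).1, towerOn_mono h n (hx a b c hm).2.1,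
      towerOn_mono h n (hx a b c hm).2.2⟩

theorem bot_mem_towerOn {V : Set S} (hV : ⊥ ∈ V) : ∀ n, (⊥ : tower S n) ∈ towerOn V n
  | 0 => hV
  | n + 1 => RExt.single_mem_supportedOn.2 (bot_mem_towerOn hV n)

theorem towerMap_mem_towerOn {V : Set S} {m n : ℕ} (h : m ≤ n) {x : tower S m}
    (hx : x ∈ towerOn V m) : towerMap S m n h x ∈ towerOn V n := by
  induction n, h using Nat.le_induction with
  | base => rwa [towerMap_self]
  | succ n h ih =>
    rw [towerMap_succ S m n h]
    exact RExt.single_mem_supportedOn.2 ih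

theorem towerMap_injective {m n : ℕ} (h : m ≤ n) : Function.Injective (towerMap S m n h) := by
  induction n, h using Nat.le_induction with
  | base => intro x y hxy; rwa [towerMap_self, towerMap_self] at hxy
  | succ n h ih =>
    intro x y hxy
    rw [towerMap_succ S m n h, towerMap_succ S m n h] at hxy
    exact ih (congrArg RExt.π hxy)

/-- Every element of an iterate is built from finitely many elements of `S`. -/
theorem exists_finite_mem_towerOn : ∀ (n : ℕ) (x : tower S n),
    ∃ V : Set S, V.Finite ∧ x ∈ towerOn V n
  | 0, x => ⟨{(x : S)}, Set.finite_singleton _, rfl⟩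
  | n + 1, x => by
    classical
    choose V hfin hV using exists_finite_mem_towerOn n
    let W : tower S n × tower S n × tower S n → Set S := fun p => V p.1 ∪ (V p.2.1 ∪ V p.2.2)
    have hW : ∀ p, (W p).Finite := fun p => (hfin _).union ((hfin _).union (hfin _))
    refine ⟨⋃ p ∈ RExt.carrier x, W p, (Finset.finite_toSet _).biUnion fun p _ => hW p,
      fun a b c h => ?_⟩
    have hsub : W (a, b, c) ⊆ ⋃ p ∈ RExt.carrier x, W p :=
      Set.subset_biUnion_of_mem (u := W) (Finset.mem_coe.2 h)
    exact ⟨towerOn_mono (Set.subset_union_left.trans hsub) n (hV a),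
      towerOn_mono ((Set.subset_union_left.trans Set.subset_union_right).trans hsub) n (hV b),
      towerOn_mono ((Set.subset_union_right.trans Set.subset_union_right).trans hsub) n (hV c)⟩

namespace DExt

theorem mk_towerMap {m n : ℕ} (h : m ≤ n) (x : tower S m) :
    mk n (towerMap S m n h x) = mk m x :=
  DirectLimit.mk_apply (F := fun n => tower S n) (f := towerMap S) m n x h

theorem mk_single (n : ℕ) (x : tower S n) :
    mk (n + 1) (RExt.single x : RExt (tower S n)) = mk n x := by
  rw [← mk_towerMap n.le_succ x, towerMap_succ S n n le_rfl, towerMap_self]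
  rfl

theorem mk_injective (n : ℕ) : Function.Injective (mk (S := S) n) :=
  DirectLimit.mk_injective (F := fun n => tower S n) (towerMap S)
    (fun _ _ h => towerMap_injective h) n

theorem mk_le_mk {n : ℕ} {x y : tower S n} : mk n x ≤ mk n y ↔ x ≤ y := by
  constructor
  · intro h
    have h' : mk n (x ⊔ y) = mk n y := (mk_sup n x y).trans (sup_eq_right.2 h)
    exact sup_eq_right.1 (mk_injective n h')
  · intro h
    exact sup_eq_right.1 ((mk_sup n x y).symm.trans (congrArg (mk n) (sup_eq_right.2 h)))

theorem emb_le_emb {x y : S} : emb S x ≤ emb S y ↔ x ≤ y := mk_le_mk (n := 0)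

/-- The elements of the union that are built from elements of `V` only. -/
def supportedOn (V : Set S) : Set (DExt S) := {x | ∃ n, ∃ a ∈ towerOn V n, mk n a = x}

theorem supportedOn_mono {V W : Set S} (h : V ⊆ W) : supportedOn V ⊆ supportedOn W :=
  fun _ ⟨n, a, ha, hx⟩ => ⟨n, a, towerOn_mono h n ha, hx⟩

theorem exists_finite_mem_supportedOn (x : DExt S) :
    ∃ V : Set S, V.Finite ∧ x ∈ supportedOn V := by
  obtain ⟨n, a, -, -, rfl, -, -⟩ := exists_mk₃ x x x
  obtain ⟨V, hfin, hV⟩ := exists_finite_mem_towerOn n a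
  exact ⟨V, hfin, n, a, hV, rfl⟩

/-- Ideals of the iterates that simultaneously induce prescribed principal ideals on the sets
`towerOn (V i) n` and a prescribed ideal on `S`. -/
theorem exists_ideal_tower {ι : Type w} (V : ι → Set S) (hV : ∀ i, ⊥ ∈ V i) (t : ι → DExt S)
    (hVt : ∀ i j, ∀ x ∈ supportedOn (V i), x ∈ supportedOn (V j) → x ≤ t i → x ≤ t j)
    (I : Order.Ideal S) (hI : ∀ i, ∀ s ∈ V i, s ∈ I ↔ emb S s ≤ t i) (n : ℕ) :
    ∃ J : Order.Ideal (tower S n), (∀ i, ∀ x ∈ towerOn (V i) n, x ∈ J ↔ mk n x ≤ t i) ∧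
      ∀ s ∈ I, towerMap S 0 n n.zero_le s ∈ J := by
  induction n with
  | zero =>
    refine ⟨I, hI, fun s hs => ?_⟩
    exact (congrArg (· ∈ I) (towerMap_self S 0 s)).mpr hs
  | succ n ih =>
    obtain ⟨J, hJ, hIJ⟩ := ih
    obtain ⟨K, hK, hJK⟩ := RExt.exists_ideal (S := tower S n) (fun x => mk (n + 1) x)
      (fun x y => mk_sup (n + 1) x y) (fun i => towerOn (V i) n)
      (fun i => bot_mem_towerOn (hV i) n) t
      (fun i j x hi hj => hVt i j _ ⟨n + 1, x, hi, rfl⟩ ⟨n + 1, x, hj, rfl⟩) J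
      (fun i s hs => by rw [mk_single]; exact hJ i s hs)
    refine ⟨K, hK, fun s hs => ?_⟩
    exact (congrArg (· ∈ K) (towerMap_succ S 0 n n.zero_le s)).mpr (hJK _ (hIJ s hs))

/-- What the amalgamation of ideals means for inequalities: if `z` is below the join of elements
`s`, `x`, `y` of the prescribed ideals, then `z` belongs to the ideal prescribed for its own
support. -/
theorem le_of_le_sup {ι : Type w} (V : ι → Set S) (hV : ∀ i, ⊥ ∈ V i) (t : ι → DExt S)
    (hVt : ∀ i j, ∀ x ∈ supportedOn (V i), x ∈ supportedOn (V j) → x ≤ t i → x ≤ t j)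
    (I : Order.Ideal S) (hI : ∀ i, ∀ s ∈ V i, s ∈ I ↔ emb S s ≤ t i)
    {i j k : ι} {s : S} {x y z : DExt S} (hs : s ∈ I) (hx : x ∈ supportedOn (V i)) (hxt : x ≤ t i)
    (hy : y ∈ supportedOn (V j)) (hyt : y ≤ t j) (hz : z ∈ supportedOn (V k))
    (h : z ≤ emb S s ⊔ (x ⊔ y)) : z ≤ t k := by
  obtain ⟨l, a, ha, rfl⟩ := hx
  obtain ⟨m, b, hb, rfl⟩ := hy
  obtain ⟨n, c, hc, rfl⟩ := hz
  obtain ⟨N, hl, hm, hn⟩ : ∃ N, l ≤ N ∧ m ≤ N ∧ n ≤ N :=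
    ⟨l + m + n, by omega, by omega, by omega⟩
  obtain ⟨J, hJ, hIJ⟩ := exists_ideal_tower V hV t hVt I hI N
  rw [← mk_towerMap hl, ← mk_towerMap hm, ← mk_towerMap hn, emb_eq N, ← mk_sup, ← mk_sup] at h
  replace h := mk_le_mk.1 h
  rw [← mk_towerMap hl] at hxt
  rw [← mk_towerMap hm] at hyt
  rw [← mk_towerMap hn]
  refine (hJ k _ (towerMap_mem_towerOn hn hc)).1 (J.lower h ?_)
  exact Order.Ideal.sup_mem (hIJ s hs) (Order.Ideal.sup_mem
    ((hJ i _ (towerMap_mem_towerOn hl ha)).2 hxt) ((hJ j _ (towerMap_mem_towerOn hm hb)).2 hyt))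

end DExt

end tower

/-! ### Supports in `G(Ω)` and evaporation -/

namespace LSemi

variable {Ω : Type u}

/-- The elements of `L(Ω)` with support in `U`: the top element, and the pairs of subsets
of `U`. -/
def supportedOn (U : Set Ω) : Set (LSemi Ω) :=
  {t | ∀ p : DisjPair Ω, t = WithTop.some p → ↑p.1.1 ⊆ U ∧ ↑p.1.2 ⊆ U}

theorem supportedOn_mono {U U' : Set Ω} (h : U ⊆ U') : supportedOn U ⊆ supportedOn U' :=
  fun _ ht p hp => ⟨(ht p hp).1.trans h, (ht p hp).2.trans h⟩

theorem bot_mem_supportedOn (U : Set Ω) : ⊥ ∈ supportedOn U := by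
  intro p hp
  have : (⊥ : DisjPair Ω) = p := WithTop.coe_injective hp
  subst this
  exact ⟨by rintro _ h; simp [Bot.bot] at h, by rintro _ h; simp [Bot.bot] at h⟩

theorem exists_finset_mem_supportedOn (t : LSemi Ω) :
    ∃ U : Finset Ω, t ∈ supportedOn (U : Set Ω) := by
  classical
  induction t using WithTop.recTopCoe with
  | top => exact ⟨∅, fun p hp => absurd hp (WithTop.top_ne_coe)⟩
  | coe q =>
    refine ⟨q.1.1 ∪ q.1.2, fun p hp => ?_⟩
    obtain rfl : q = p := WithTop.coe_injective hp
    simp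

/-- The join of the generators `a₀(ξ)`, for `b = false`, or `a₁(ξ)`, for `b = true`, over
all `ξ ∈ X`. -/
def gen (b : Bool) (X : Finset Ω) : LSemi Ω :=
  WithTop.some (bif b then DisjPair.mk ∅ X (Finset.disjoint_empty_left _)
    else DisjPair.mk X ∅ (Finset.disjoint_empty_right _))

theorem gen_mono (b : Bool) {X Y : Finset Ω} (h : X ⊆ Y) : gen b X ≤ gen b Y := by
  refine WithTop.coe_le_coe.2 ?_
  cases b
  · exact ⟨h, subset_rfl⟩
  · exact ⟨subset_rfl, h⟩

theorem gen_sup_gen (ξ : Ω) : gen false {ξ} ⊔ gen true {ξ} = (⊤ : LSemi Ω) := by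
  classical
  refine dif_neg fun h => ?_
  exact Finset.disjoint_left.1 h (Finset.mem_union_left _ (Finset.mem_singleton_self ξ))
    (Finset.mem_union_right _ (Finset.mem_singleton_self ξ))

theorem eq_bot_of_le_gen {b : Bool} {X : Finset Ω} {U : Set Ω} (hU : ∀ ξ ∈ X, ξ ∉ U)
    {t : LSemi Ω} (ht : t ∈ supportedOn U) (h : t ≤ gen b X) : t = ⊥ := by
  induction t using WithTop.recTopCoe with
  | top => exact absurd h (by exact WithTop.not_top_le_coe _)
  | coe q =>
    obtain ⟨h₁, h₂⟩ := ht q rfl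
    have hq : q.1.1 = ∅ ∧ q.1.2 = ∅ := by
      have h' := WithTop.coe_le_coe.1 h
      cases b
      · exact ⟨Finset.eq_empty_of_forall_notMem fun ξ hξ => hU ξ (h'.1 hξ) (h₁ hξ),
          Finset.subset_empty.1 h'.2⟩
      · exact ⟨Finset.subset_empty.1 h'.1,
          Finset.eq_empty_of_forall_notMem fun ξ hξ => hU ξ (h'.2 hξ) (h₂ hξ)⟩
    exact congrArg WithTop.some (Subtype.ext (Prod.ext hq.1 hq.2))

theorem eq_bot_of_le_gen_of_le_gen {b b' : Bool} {X Y : Finset Ω} (h : Disjoint X Y)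
    {t : LSemi Ω} (hX : t ≤ gen b X) (hY : t ≤ gen b' Y) : t = ⊥ := by
  refine eq_bot_of_le_gen (U := {ξ | ξ ∈ Y}) (fun ξ hξ => Finset.disjoint_left.1 h hξ) ?_ hX
  rintro q rfl
  have h' := WithTop.coe_le_coe.1 hY
  cases b'
  · exact ⟨fun ξ hξ => h'.1 hξ, fun ξ hξ => absurd (h'.2 hξ) (Finset.notMem_empty ξ)⟩
  · exact ⟨fun ξ hξ => absurd (h'.1 hξ) (Finset.notMem_empty ξ), fun ξ hξ => h'.2 hξ⟩

end LSemi

namespace GSemi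

open LSemi

variable {Ω : Type u}

/-- The elements of `G(Ω)` with support in `U`; this is the copy of `G(U)` in `G(Ω)`. -/
def supportedOn (U : Set Ω) : Set (GSemi Ω) := DExt.supportedOn (LSemi.supportedOn U)

theorem supportedOn_mono {U U' : Set Ω} (h : U ⊆ U') :
    supportedOn U ⊆ (supportedOn U' : Set (GSemi Ω)) :=
  DExt.supportedOn_mono (LSemi.supportedOn_mono h)

/-- Every element of `G(Ω)` has a finite support. -/
theorem exists_finset_mem_supportedOn (x : GSemi Ω) :
    ∃ U : Finset Ω, x ∈ supportedOn (U : Set Ω) := by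
  classical
  obtain ⟨V, hfin, hV⟩ := DExt.exists_finite_mem_supportedOn x
  choose W hW using LSemi.exists_finset_mem_supportedOn (Ω := Ω)
  refine ⟨hfin.toFinset.biUnion W, DExt.supportedOn_mono (fun t ht => ?_) hV⟩
  refine LSemi.supportedOn_mono ?_ (hW t)
  exact_mod_cast Finset.subset_biUnion_of_mem W (hfin.mem_toFinset.2 ht)

theorem bot_mem_supportedOn (U : Set Ω) : (⊥ : GSemi Ω) ∈ supportedOn U :=
  ⟨0, ⊥, LSemi.bot_mem_supportedOn U, rfl⟩

/-- An element below a join of generators whose indices lie outside its support is zero. -/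
theorem eq_bot_of_le_emb_gen {b : Bool} {X : Finset Ω} {U : Set Ω} (hU : ∀ ξ ∈ X, ξ ∉ U)
    {z : GSemi Ω} (hz : z ∈ supportedOn U) (h : z ≤ DExt.emb _ (gen b X)) : z = ⊥ := by
  refine le_bot_iff.1 (DExt.le_of_le_sup (fun _ : Unit => LSemi.supportedOn U)
    (fun _ => LSemi.bot_mem_supportedOn U) (fun _ => ⊥) (fun _ _ _ _ _ h => h)
    (Order.Ideal.principal (gen b X)) (fun _ s hs => ?_) (i := ()) (j := ()) (k := ())
    Order.Ideal.mem_principal_self (bot_mem_supportedOn U) le_rfl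
    (bot_mem_supportedOn U) le_rfl hz (h.trans le_sup_left))
  rw [Order.Ideal.mem_principal]
  refine ⟨fun h => ?_, fun h => ?_⟩
  · rw [eq_bot_of_le_gen hU hs h]
    exact le_rfl
  · exact (DExt.emb_le_emb.1 h).trans bot_le

/-- The Evaporation Lemma. The ideals `↓x`, `↓y`, `{⊥}`, prescribed on the elements with support in
`X₁ᶜ`, `X₀ᶜ`, `{δ}ᶜ`, respectively, contain no nonzero element with support in two of these sets,
because of the upper bounds on `x` and `y`. Hence they can be amalgamated to
one ideal; it contains `x ⊔ y`, hence `z`. -/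
theorem eq_bot_of_le_sup {b b₀ b₁ : Bool} {δ : Ω} {X₀ X₁ : Finset Ω} (h₀ : δ ∉ X₀)
    (h₁ : δ ∉ X₁) {x y z : GSemi Ω}
    (hx : x ∈ supportedOn {ξ | ξ ∉ X₁}) (hxδ : x ≤ DExt.emb _ (gen b₀ {δ}))
    (hxX : x ≤ DExt.emb _ (gen b X₀))
    (hy : y ∈ supportedOn {ξ | ξ ∉ X₀}) (hyδ : y ≤ DExt.emb _ (gen b₁ {δ}))
    (hyX : y ≤ DExt.emb _ (gen b X₁))
    (hz : z ∈ supportedOn {ξ | ξ ∉ ({δ} : Finset Ω)}) (h : z ≤ x ⊔ y) : z = ⊥ := by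
  have h' : z ≤ DExt.emb _ ⊥ ⊔ (x ⊔ y) := h.trans le_sup_right
  refine le_bot_iff.1 (DExt.le_of_le_sup
    ![LSemi.supportedOn {ξ | ξ ∉ X₁}, LSemi.supportedOn {ξ | ξ ∉ X₀},
      LSemi.supportedOn {ξ | ξ ∉ ({δ} : Finset Ω)}]
    ?_ ![x, y, ⊥] ?_ (Order.Ideal.principal ⊥) ?_ (i := 0) (j := 1) (k := 2)
    Order.Ideal.mem_principal_self hx le_rfl hy le_rfl hz h')
  · intro i
    fin_cases i <;> exact LSemi.bot_mem_supportedOn _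
  · have key : ∀ {b : Bool} {X : Finset Ω} {w v u : GSemi Ω}, v ≤ DExt.emb _ (gen b X) →
        w ∈ supportedOn {ξ | ξ ∉ X} → w ≤ v → w ≤ u := by
      intro b X w v u hv hw hwv
      rw [eq_bot_of_le_emb_gen (U := {ξ | ξ ∉ X}) (fun ξ hξ hξ' => hξ' hξ) hw (hwv.trans hv)]
      exact bot_le
    intro i j w hi hj hw
    fin_cases i <;> fin_cases j
    · exact hw
    · exact key hxX hj hw
    · exact key hxδ hj hw
    · exact key hyX hj hw
    · exact hw
    · exact key hyδ hj hw
    · exact hw.trans bot_le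
    · exact hw.trans bot_le
    · exact hw
  · intro i s _
    rw [Order.Ideal.mem_principal]
    refine ⟨fun h => ?_, fun h => ?_⟩
    · rw [le_bot_iff.1 h]
      exact bot_le
    · rw [le_bot_iff]
      fin_cases i
      · exact eq_bot_of_le_gen_of_le_gen (Finset.disjoint_singleton_right.2 h₀)
          (DExt.emb_le_emb.1 (h.trans hxX)) (DExt.emb_le_emb.1 (h.trans hxδ))
      · exact eq_bot_of_le_gen_of_le_gen (Finset.disjoint_singleton_right.2 h₁)
          (DExt.emb_le_emb.1 (h.trans hyX)) (DExt.emb_le_emb.1 (h.trans hyδ))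
      · exact le_bot_iff.1 (DExt.emb_le_emb.1 h)

end GSemi

/-! ### Kuratowski's free set theorem -/

section Cardinal

open Cardinal

variable {Ω : Type u}

/-- Kuratowski's free set theorem, in the form where the set mapping `Φ` is defined on
all finite sets: in a set of cardinality at least `ℵ_m` there are `m + 1` elements none of which
belongs to `Φ F`, for any set `F` of some of the other ones. -/
theorem exists_free_finset (m : ℕ) : ∀ (U : Set Ω), ℵ_ (m : Ordinal) ≤ #U →
    ∀ Φ : Finset Ω → Finset Ω, ∃ H : Finset Ω, ↑H ⊆ U ∧ H.card = m + 1 ∧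
      ∀ ξ ∈ H, ∀ F ⊆ H, ξ ∉ F → ξ ∉ Φ F := by
  classical
  induction m with
  | zero =>
    intro U hU Φ
    have hinf : U.Infinite := by
      rw [← Set.infinite_coe_iff, ← Cardinal.aleph0_le_mk_iff]
      simpa using hU
    obtain ⟨ξ, hξ, hξΦ⟩ := hinf.exists_notMem_finset (Φ ∅)
    refine ⟨{ξ}, by simpa using hξ, by simp, fun η hη F hF hηF => ?_⟩
    obtain rfl := Finset.mem_singleton.1 hη
    rcases Finset.subset_singleton_iff.1 hF with rfl | rfl
    · exact hξΦ
    · exact absurd hη hηF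
  | succ m ih =>
    intro U hU Φ
    obtain ⟨U', hU'U, hU'⟩ := Cardinal.le_mk_iff_exists_subset.1
      ((aleph_le_aleph.2 (by exact_mod_cast m.le_succ)).trans hU :
        ℵ_ (m : Ordinal) ≤ #U)
    have hinf : ℵ₀ ≤ #U' := by rw [hU']; exact aleph0_le_aleph _
    -- the values of `Φ` at finite subsets of `U'` do not exhaust `U`
    let B : Set Ω := U' ∪ ⋃ F : Finset U', (Φ (F.map (Function.Embedding.subtype _)) : Set Ω)
    have hB : #B ≤ ℵ_ (m : Ordinal) := by
      have : Infinite U' := Cardinal.infinite_iff.2 hinf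
      refine (mk_union_le _ _).trans (add_le_of_le (aleph0_le_aleph _) hU'.le ?_)
      refine (mk_iUnion_le _).trans ?_
      rw [mk_finset_of_infinite, hU']
      refine mul_le_of_le (aleph0_le_aleph _) le_rfl ((ciSup_le' fun F => ?_).trans
        (aleph0_le_aleph _))
      exact (Finset.finite_toSet _).lt_aleph0.le
    obtain ⟨ξ, hξU, hξB⟩ : ∃ ξ ∈ U, ξ ∉ B := by
      by_contra! hsub
      have h := (hU.trans (mk_le_mk_of_subset hsub)).trans hB
      rw [aleph_le_aleph] at h
      exact absurd h (by exact_mod_cast Nat.not_succ_le_self m)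
    obtain ⟨H, hHU', hcard, hH⟩ := ih U' hU'.ge fun F => Φ F ∪ Φ (insert ξ F)
    have hξH : ξ ∉ H := fun h => hξB (Or.inl (hHU' h))
    refine ⟨insert ξ H, ?_, by rw [Finset.card_insert_of_notMem hξH, hcard], ?_⟩
    · rw [Finset.coe_insert]
      exact Set.insert_subset hξU (hHU'.trans hU'U)
    intro η hη F hF hηF
    rcases Finset.mem_insert.1 hη with rfl | hη
    · have hFH : F ⊆ H := (Finset.subset_insert_iff_of_notMem hηF).1 hF
      intro hηΦ
      refine hξB (Or.inr (Set.mem_iUnion.2 ⟨F.subtype (· ∈ U'), ?_⟩))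
      rwa [Finset.subtype_map_of_mem fun x hx => hHU' (hFH hx)]
    · have h := hH η hη (F.erase ξ) (Finset.subset_insert_iff.1 hF)
        fun h => hηF (Finset.mem_of_mem_erase h)
      rw [Finset.mem_union, not_or] at h
      by_cases hξF : ξ ∈ F
      · rw [Finset.insert_erase hξF] at h
        exact h.2
      · rw [Finset.erase_eq_of_notMem hξF] at h
        exact h.1

/-- The cardinality `ℵ_ω` has countable cofinality, so a map to `ℕ` need not have a large fiber on a
set of that size; the next cardinal suffices. -/
theorem exists_large_fiber (hΩ : ℵ_ (Ordinal.omega0 + 1) ≤ #Ω) (N : Ω → ℕ) :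
    ∃ n, ∀ m : ℕ, ℵ_ (m : Ordinal) ≤ #(N ⁻¹' {n}) := by
  by_contra! h
  choose m hm using h
  have hle : #Ω ≤ ℵ_ Ordinal.omega0 := by
    rw [← mk_univ, ← Set.preimage_univ (f := N), ← Set.iUnion_of_singleton ℕ, Set.preimage_iUnion]
    have h := mk_iUnion_le_lift.{u, 0} fun n => N ⁻¹' {n}
    simp only [lift_uzero, mk_nat, lift_aleph0] at h
    refine h.trans (mul_le_of_le (aleph0_le_aleph _) (aleph0_le_aleph _) (ciSup_le' fun n => ?_))
    exact (hm n).le.trans (aleph_le_aleph.2 (Ordinal.natCast_lt_omega0 _).le)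
  have h := hΩ.trans hle
  rw [aleph_le_aleph] at h
  exact absurd h (not_le.2 (lt_add_one _))

end Cardinal

/-! ### Congruences of algebras with a compatible lattice structure -/

namespace AlgStr

variable {L : Type u} (A : AlgStr.{u, v} L)

/-- Joins of congruences are joins of equivalence relations. -/
theorem sup_val (s t : A.Congr) : (s ⊔ t).1 = s.1 ⊔ t.1 := by
  classical
  have hop : ∀ o : A.Op, IsCongruenceFor (s.1 ⊔ t.1) (A.op o) := by
    intro o x y hxy
    -- one coordinate may be changed along `s` or `t`, hence along their join
    have hone : ∀ (w : Fin (A.arity o) → L) i a b, (s.1 ⊔ t.1) a b →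
        (s.1 ⊔ t.1) (A.op o (Function.update w i a)) (A.op o (Function.update w i b)) := by
      intro w i
      have hle : ∀ r : A.Congr, r.1 ≤ s.1 ⊔ t.1 →
          r.1 ≤ (s.1 ⊔ t.1).comap fun a => A.op o (Function.update w i a) := by
        intro r hr a b hab
        refine hr (r.2 o _ _ fun j => ?_)
        rcases eq_or_ne j i with rfl | hj
        · simpa using hab
        · simp [hj]
      intro a b hab
      exact sup_le (hle s le_sup_left) (hle t le_sup_right) hab
    have hall : ∀ F : Finset (Fin (A.arity o)),
        (s.1 ⊔ t.1) (A.op o x) (A.op o (F.piecewise y x)) := by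
      intro F
      induction F using Finset.induction_on with
      | empty => rw [Finset.piecewise_empty]
      | insert i F hi ih =>
        refine (s.1 ⊔ t.1).trans ih ?_
        have h := hone (F.piecewise y x) i (x i) (y i) (hxy i)
        rw [Finset.piecewise_insert]
        have hx : Function.update (F.piecewise y x) i (x i) = F.piecewise y x := by
          rw [Function.update_eq_self_iff, Finset.piecewise_eq_of_notMem _ _ _ hi]
        rwa [hx] at h
    simpa using hall Finset.univ
  refine le_antisymm ?_ (sup_le (le_sup_left : s ≤ s ⊔ t) (le_sup_right : t ≤ s ⊔ t))
  have h : s ⊔ t ≤ ⟨s.1 ⊔ t.1, hop⟩ :=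
    sup_le (show s.1 ≤ s.1 ⊔ t.1 from le_sup_left) (show t.1 ≤ s.1 ⊔ t.1 from le_sup_right)
  exact h

/-- The principal congruence `Θ(x, y)` as a finitely generated congruence. -/
def theta (x y : L) : A.Conc := ⟨A.principal x y, {(x, y)}, Finset.sup_singleton.symm⟩

variable {A}

theorem theta_le_iff {x y : L} {θ : A.Conc} : A.theta x y ≤ θ ↔ θ.1.1 x y := by
  constructor
  · intro h
    have h' : A.principal x y ≤ θ.1 := h
    refine h' ?_
    rintro _ ⟨s, hs, rfl⟩
    exact hs
  · intro h
    have h' : A.principal x y ≤ θ.1 := sInf_le h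
    exact h'

theorem rel_theta (x y : L) : (A.theta x y).1.1 x y := theta_le_iff.1 le_rfl

theorem theta_sup_val (θ η : A.Conc) : (θ ⊔ η).1.1 = θ.1.1 ⊔ η.1.1 := A.sup_val θ.1 η.1

section Lattice

variable [Lattice L]

theorem CongruenceCompatibleLattice.rel_sup (hA : A.CongruenceCompatibleLattice) (θ : A.Conc)
    {a b : L} (h : θ.1.1 a b) (c : L) :
    θ.1.1 (a ⊔ c) (b ⊔ c) := by
  refine hA.1 θ.1 ![a, c] ![b, c] fun i => ?_
  fin_cases i
  · exact h
  · exact θ.1.1.refl c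

theorem CongruenceCompatibleLattice.rel_inf (hA : A.CongruenceCompatibleLattice) (θ : A.Conc)
    {a b : L} (h : θ.1.1 a b) (c : L) :
    θ.1.1 (a ⊓ c) (b ⊓ c) := by
  refine hA.2 θ.1 ![a, c] ![b, c] fun i => ?_
  fin_cases i
  · exact h
  · exact θ.1.1.refl c

end Lattice
end AlgStr

namespace AlgStr

variable {L : Type u} {A : AlgStr.{u, v} L} [Lattice L]

/-- `Θ(x, y) ⊆ Θ(a, b)` whenever `x` and `y` lie between `a` and `b`. -/
theorem CongruenceCompatibleLattice.theta_le_theta (hA : A.CongruenceCompatibleLattice)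
    {a b x y : L} (hax : a ≤ x) (hxb : x ≤ b) (hay : a ≤ y) (hyb : y ≤ b) :
    A.theta x y ≤ A.theta a b := by
  have h : ∀ w, a ≤ w → w ≤ b → (A.theta a b).1.1 w b := by
    intro w haw hwb
    have h' := hA.rel_sup (A.theta a b) (rel_theta a b) w
    rwa [sup_eq_right.2 haw, sup_eq_left.2 hwb] at h'
  exact theta_le_iff.2 ((A.theta a b).1.1.trans (h x hax hxb)
    ((A.theta a b).1.1.symm (h y hay hyb)))

/-- Every finitely generated congruence is contained in a principal one. -/
theorem CongruenceCompatibleLattice.exists_le_theta (hA : A.CongruenceCompatibleLattice)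
    [Nonempty L] (θ : A.Conc) : ∃ a b : L, a ≤ b ∧ θ ≤ A.theta a b := by
  classical
  obtain ⟨_, F, rfl⟩ := θ
  obtain ⟨b, hb⟩ := (F.image Prod.fst ∪ F.image Prod.snd).exists_le
  obtain ⟨a, ha⟩ := (insert b (F.image Prod.fst ∪ F.image Prod.snd)).exists_le (α := Lᵒᵈ)
  refine ⟨a, b, ha b (Finset.mem_insert_self _ _), ?_⟩
  have h : (F.sup fun p => A.principal p.1 p.2) ≤ (A.theta a b).1 := by
    refine Finset.sup_le fun p hp => ?_
    have h₁ : p.1 ∈ F.image Prod.fst ∪ F.image Prod.snd :=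
      Finset.mem_union_left _ (Finset.mem_image_of_mem _ hp)
    have h₂ : p.2 ∈ F.image Prod.fst ∪ F.image Prod.snd :=
      Finset.mem_union_right _ (Finset.mem_image_of_mem _ hp)
    exact hA.theta_le_theta (ha _ (Finset.mem_insert_of_mem h₁)) (hb _ h₁)
      (ha _ (Finset.mem_insert_of_mem h₂)) (hb _ h₂)
  exact h

/-- If `a ≤ b` are identified by the join of two congruences, then they are joined by
a sequence of elements below `b` whose steps belong alternately to the two congruences. -/
theorem CongruenceCompatibleLattice.exists_chain (hA : A.CongruenceCompatibleLattice)
    {a b : L} (hab : a ≤ b) (θ : Bool → A.Conc) (h : A.theta a b ≤ θ false ⊔ θ true) :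
    ∃ (n : ℕ) (z : ℕ → L), z 0 = a ∧ z n = b ∧ (∀ i, z i ≤ b) ∧
      ∀ i < n, (θ i.bodd).1.1 (z i) (z (i + 1)) := by
  -- the set of all `c` that can be reached from `a` in an even number of steps
  let B : Set L := {c | ∃ (m : ℕ) (z : ℕ → L), z 0 = a ∧ z (2 * m) = c ∧
    ∀ i < 2 * m, (θ i.bodd).1.1 (z i) (z (i + 1))}
  have hstep : ∀ c d e, c ∈ B → (θ false).1.1 c d → (θ true).1.1 d e → e ∈ B := by
    rintro c d e ⟨m, z, hz0, hzm, hz⟩ hcd hde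
    refine ⟨m + 1, fun i => if i ≤ 2 * m then z i else if i = 2 * m + 1 then d else e,
      by simp [hz0], by simp; omega, fun i hi => ?_⟩
    have hb : (2 * m).bodd = false := by simp [Nat.bodd_mul]
    have hb' : (2 * m + 1).bodd = true := by rw [Nat.bodd_succ, hb]; rfl
    rcases lt_trichotomy i (2 * m) with h | rfl | h
    · have h₁ : i ≤ 2 * m := by omega
      have h₂ : i + 1 ≤ 2 * m := by omega
      simpa [h₁, h₂] using hz i h
    · rw [hb]; simpa [hzm] using hcd
    · obtain rfl : i = 2 * m + 1 := by omega
      rw [hb']; simpa using hde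
  -- `B` is a union of classes of both congruences, hence of classes of their join
  have hle : ∀ β, (θ β).1.1 ≤ ((⊥ : Setoid Prop).comap (· ∈ B)) := by
    have hB : ∀ β c d, (θ β).1.1 c d → c ∈ B → d ∈ B := by
      intro β c d hcd hc
      cases β
      · exact hstep c d d hc hcd ((θ true).1.1.refl d)
      · exact hstep c c d hc ((θ false).1.1.refl c) hcd
    intro β c d hcd
    exact propext ⟨hB β c d hcd, hB β d c ((θ β).1.1.symm hcd)⟩
  have hrel := theta_le_iff.1 h
  rw [theta_sup_val] at hrel
  have haB : a ∈ B := ⟨0, fun _ => a, rfl, rfl, by simp⟩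
  have hbB : b ∈ B := by
    have h' : (a ∈ B) = (b ∈ B) := sup_le (hle false) (hle true) hrel
    rwa [← h']
  obtain ⟨m, z, hz0, hzm, hz⟩ := hbB
  exact ⟨2 * m, fun i => z i ⊓ b, by simp [hz0, hab], by simp [hzm], fun i => inf_le_right,
    fun i hi => hA.rel_inf _ (hz i hi) b⟩

end AlgStr

/-! ### Erosion and the collapse of `Θ(a, b)` -/

open AlgStr

section

variable {Ω : Type w} {L : Type u} {A : AlgStr.{u, v} L}

theorem map_mono_of_sup (μ : SupBotHom A.Conc (GSemi Ω)) {x y : A.Conc} (h : x ≤ y) :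
    μ x ≤ μ y := by
  have h' : μ (x ⊔ y) = μ x ⊔ μ y := map_sup μ x y
  rw [sup_eq_right.2 h] at h'
  rw [h']
  exact le_sup_left

theorem map_sup_le (μ : SupBotHom A.Conc (GSemi Ω)) {x y : A.Conc} {g : GSemi Ω}
    (hx : μ x ≤ g) (hy : μ y ≤ g) : μ (x ⊔ y) ≤ g := by
  have h' : μ (x ⊔ y) = μ x ⊔ μ y := map_sup μ x y
  rw [h']
  exact sup_le hx hy

theorem map_finset_sup_le (μ : SupBotHom A.Conc (GSemi Ω)) {ι : Type*} (F : Finset ι)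
    (f : ι → A.Conc) {g : GSemi Ω} (h : ∀ i ∈ F, μ (f i) ≤ g) : μ (F.sup f) ≤ g := by
  classical
  induction F using Finset.induction_on with
  | empty =>
    rw [Finset.sup_empty, show μ ⊥ = ⊥ from map_bot μ]
    exact bot_le
  | insert i F _ ih =>
    rw [Finset.sup_insert]
    exact map_sup_le μ (h i (Finset.mem_insert_self _ _))
      (ih fun j hj => h j (Finset.mem_insert_of_mem hj))

variable [Lattice L]

open Classical in
/-- The join of the `i`-th terms of the sequences `z ξ`, for `ξ ∈ X`, and of the element `a`. -/
noncomputable def level (a : L) (z : Ω → ℕ → L) (X : Finset Ω) (i : ℕ) : L :=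
  (insert a (X.image fun ξ => z ξ i)).sup' (Finset.insert_nonempty _ _) id

theorem level_le_iff {a : L} {z : Ω → ℕ → L} {X : Finset Ω} {i : ℕ} {c : L} :
    level a z X i ≤ c ↔ a ≤ c ∧ ∀ ξ ∈ X, z ξ i ≤ c := by
  simp [level, Finset.sup'_le_iff]

theorem level_union [DecidableEq Ω] (a : L) (z : Ω → ℕ → L) (X Y : Finset Ω) (i : ℕ) :
    level a z (X ∪ Y) i = level a z X i ⊔ level a z Y i := by
  refine eq_of_forall_ge_iff fun c => ?_
  rw [sup_le_iff, level_le_iff, level_le_iff, level_le_iff, Finset.forall_mem_union]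
  tauto

theorem level_insert [DecidableEq Ω] (a : L) (z : Ω → ℕ → L) (η : Ω) (X : Finset Ω) (i : ℕ) :
    level a z (insert η X) i = level a z X i ⊔ z η i := by
  refine eq_of_forall_ge_iff fun c => ?_
  rw [sup_le_iff, level_le_iff, level_le_iff, Finset.forall_mem_insert]
  tauto

/-- The congruence `⋁ Θ(x ∨ zᵢ, x ∨ zᵢ₊₁)`, where `i < n` ranges over the
indices of parity `β`. -/
def erosion (A : AlgStr.{u, v} L) (n : ℕ) (z : ℕ → L) (x : L) (β : Bool) : A.Conc :=
  ((Finset.range n).filter fun i => i.bodd = β).sup fun i => A.theta (z i ⊔ x) (z (i + 1) ⊔ x)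

/-- The Erosion Lemma, first part: the two congruences obtained from `x` and `y`, for
different parities, jointly identify the joins of `x ∨ y` with the two ends of the sequence `z`. -/
theorem theta_le_erosion_sup (hA : A.CongruenceCompatibleLattice) (n : ℕ) (z : ℕ → L) (x y : L) :
    A.theta (z 0 ⊔ (x ⊔ y)) (z n ⊔ (x ⊔ y)) ≤ erosion A n z x false ⊔ erosion A n z y true := by
  set θ := erosion A n z x false ⊔ erosion A n z y true with hθ
  have hstep : ∀ i < n, θ.1.1 (z i ⊔ (x ⊔ y)) (z (i + 1) ⊔ (x ⊔ y)) := by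
    intro i hi
    rcases hb : i.bodd with _ | _
    · have h : A.theta (z i ⊔ x) (z (i + 1) ⊔ x) ≤ θ := le_sup_of_le_left
        (Finset.le_sup (f := fun i => A.theta (z i ⊔ x) (z (i + 1) ⊔ x)) (by simp [hi, hb]))
      have h' := hA.rel_sup θ (theta_le_iff.1 h) y
      rwa [sup_assoc, sup_assoc] at h'
    · have h : A.theta (z i ⊔ y) (z (i + 1) ⊔ y) ≤ θ := le_sup_of_le_right
        (Finset.le_sup (f := fun i => A.theta (z i ⊔ y) (z (i + 1) ⊔ y)) (by simp [hi, hb]))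
      have h' := hA.rel_sup θ (theta_le_iff.1 h) x
      rwa [sup_assoc, sup_assoc, sup_comm y x] at h'
  have hall : ∀ i ≤ n, θ.1.1 (z 0 ⊔ (x ⊔ y)) (z i ⊔ (x ⊔ y)) := by
    intro i
    induction i with
    | zero => exact fun _ => θ.1.1.refl _
    | succ i ih => exact fun hi => θ.1.1.trans (ih (by omega)) (hstep i (by omega))
  exact theta_le_iff.2 (hall n le_rfl)

/-- The Erosion Lemma, second part: the congruence obtained from `x` and the parity `β` is
bounded by the join of the steps of parity `β`. -/
theorem map_erosion_le (hA : A.CongruenceCompatibleLattice) (μ : SupBotHom A.Conc (GSemi Ω))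
    {n : ℕ} {z : ℕ → L} (x : L) {β : Bool} {g : GSemi Ω}
    (h : ∀ i < n, i.bodd = β → μ (A.theta (z i) (z (i + 1))) ≤ g) :
    μ (erosion A n z x β) ≤ g := by
  refine map_finset_sup_le μ _ _ fun i hi => ?_
  rw [Finset.mem_filter, Finset.mem_range] at hi
  refine (map_mono_of_sup μ ?_).trans (h i hi.1 hi.2)
  exact theta_le_iff.2 (hA.rel_sup _ (rel_theta _ _) x)

/-- The Erosion Lemma, third part: the congruence obtained from `x` is contained in any
congruence forcing all `zᵢ` below `x`. -/
theorem erosion_le_theta (hA : A.CongruenceCompatibleLattice) {n : ℕ} {z : ℕ → L} {x b : L}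
    (hx : x ≤ b) (hz : ∀ i, z i ≤ b) (β : Bool) : erosion A n z x β ≤ A.theta x b :=
  Finset.sup_le fun _ _ => hA.theta_le_theta le_sup_right (sup_le (hz _) hx) le_sup_right
    (sup_le (hz _) hx)

theorem map_theta_level_le (hA : A.CongruenceCompatibleLattice) (μ : SupBotHom A.Conc (GSemi Ω))
    (a : L) (z : Ω → ℕ → L) (i : ℕ) (X : Finset Ω) {g : GSemi Ω}
    (h : ∀ ξ ∈ X, μ (A.theta (z ξ i) (z ξ (i + 1))) ≤ g) :
    μ (A.theta (level a z X i) (level a z X (i + 1))) ≤ g := by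
  classical
  refine (map_mono_of_sup μ ?_).trans (map_finset_sup_le μ X _ h)
  generalize hθ : X.sup (fun ξ => A.theta (z ξ i) (z ξ (i + 1))) = θ
  have hX : ∀ Y ⊆ X, θ.1.1 (level a z Y i) (level a z Y (i + 1)) := by
    intro Y
    induction Y using Finset.induction_on with
    | empty => exact fun _ => θ.1.1.refl _
    | insert η Y _ ih =>
      intro hY
      rw [level_insert, level_insert]
      have h₁ := hA.rel_sup θ (ih ((Finset.subset_insert η Y).trans hY)) (z η i)
      have hη : A.theta (z η i) (z η (i + 1)) ≤ θ := hθ ▸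
        Finset.le_sup (f := fun ξ => A.theta (z ξ i) (z ξ (i + 1)))
          (hY (Finset.mem_insert_self _ _))
      have h₂ := hA.rel_sup θ (theta_le_iff.1 hη) (level a z Y (i + 1))
      rw [sup_comm, sup_comm (z η (i + 1))] at h₂
      exact θ.1.1.trans h₁ h₂
  exact theta_le_iff.2 (hX X subset_rfl)

/-- If there are large enough sets of indices `ξ` for which `a ≤ b` are joined by a sequence of
`n` steps whose images under `μ` are alternately below `a₀(ξ)` and `a₁(ξ)`, then `μ`
annihilates `Θ(a, b)`. -/
theorem map_theta_eq_bot (hA : A.CongruenceCompatibleLattice) (μ : SupBotHom A.Conc (GSemi Ω))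
    {a b : L} (hab : a ≤ b) (n : ℕ) (U : Set Ω)
    (hU : ∀ m : ℕ, Cardinal.aleph (m : Ordinal) ≤ Cardinal.mk U) (z : Ω → ℕ → L)
    (hz0 : ∀ ξ ∈ U, z ξ 0 = a) (hzn : ∀ ξ ∈ U, z ξ n = b) (hzb : ∀ ξ ∈ U, ∀ i, z ξ i ≤ b)
    (hμ : ∀ ξ ∈ U, ∀ i < n,
      μ (A.theta (z ξ i) (z ξ (i + 1))) ≤ DExt.emb _ (LSemi.gen i.bodd {ξ})) :
    μ (A.theta a b) = ⊥ := by
  classical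
  choose supp hsupp using GSemi.exists_finset_mem_supportedOn (Ω := Ω)
  -- the supports of all relevant elements that are determined by a set of indices
  let Φ : Finset Ω → Finset Ω := fun F => (F.powerset ×ˢ Finset.range (n + 1)).biUnion fun p =>
    supp (μ (A.theta (level a z p.1 p.2) b)) ∪ F.biUnion fun δ =>
      supp (μ (erosion A n (z δ) (level a z p.1 p.2) false)) ∪
        supp (μ (erosion A n (z δ) (level a z p.1 p.2) true))
  obtain ⟨H, hHU, hcard, hH⟩ := exists_free_finset (2 ^ n) U (hU _) Φ
  have hsupp₁ : ∀ X ⊆ H, ∀ k ≤ n, ∀ δ ∈ H, δ ∉ X →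
      μ (A.theta (level a z X k) b) ∈ GSemi.supportedOn {ξ | ξ ∉ ({δ} : Finset Ω)} := by
    intro X hX k hk δ hδ hδX
    refine GSemi.supportedOn_mono (fun ξ hξ hξδ => ?_) (hsupp _)
    obtain rfl := Finset.mem_singleton.1 hξδ
    refine hH ξ hδ X hX hδX (Finset.mem_biUnion.2 ⟨(X, k), ?_, Finset.mem_union_left _ hξ⟩)
    simp only [Finset.mem_product, Finset.mem_powerset, Finset.mem_range]
    exact ⟨subset_rfl, by omega⟩
  have hsupp₂ : ∀ X ⊆ H, ∀ Y ⊆ H, Disjoint X Y → ∀ k ≤ n, ∀ δ ∈ H, δ ∉ Y → ∀ β,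
      μ (erosion A n (z δ) (level a z X k) β) ∈ GSemi.supportedOn {ξ | ξ ∉ Y} := by
    intro X hX Y hY hXY k hk δ hδ hδY β
    refine GSemi.supportedOn_mono (fun ξ hξ hξY => ?_) (hsupp _)
    refine hH ξ (hY hξY) (insert δ X) (Finset.insert_subset hδ hX) ?_
      (Finset.mem_biUnion.2 ⟨(X, k), ?_, Finset.mem_union_right _
        (Finset.mem_biUnion.2 ⟨δ, Finset.mem_insert_self _ _, ?_⟩)⟩)
    · rw [Finset.mem_insert, not_or]
      exact ⟨fun h => hδY (h ▸ hξY), fun h => Finset.disjoint_left.1 hXY h hξY⟩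
    · simp only [Finset.mem_product, Finset.mem_powerset, Finset.mem_range]
      exact ⟨Finset.subset_insert _ _, by omega⟩
    · cases β
      · exact Finset.mem_union_left _ hξ
      · exact Finset.mem_union_right _ hξ
  have hlevel : ∀ X ⊆ H, ∀ k, level a z X k ≤ b := fun X hX k =>
    level_le_iff.2 ⟨hab, fun ξ hξ => hzb ξ (hHU (hX hξ)) k⟩
  have key : ∀ l k, l + k = n → ∀ X ⊆ H, X.card = 2 ^ l →
      μ (A.theta (level a z X k) b) = ⊥ := by
    intro l
    induction l with
    | zero =>
      intro k hk X hX hXc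
      obtain ⟨ξ, hξ⟩ : X.Nonempty := Finset.card_pos.1 (by simp [hXc])
      obtain rfl : k = n := by omega
      have hb : level a z X k = b :=
        le_antisymm (hlevel X hX k) (hzn ξ (hHU (hX hξ)) ▸ (level_le_iff.1 le_rfl).2 ξ hξ)
      have h : A.theta b b ≤ ⊥ := theta_le_iff.2 (Setoid.refl' _ b)
      rw [hb, le_bot_iff.1 h]
      exact map_bot μ
    | succ l ih =>
      intro k hk X hX hXc
      obtain ⟨X₀, hX₀, hX₀c⟩ := Finset.exists_subset_card_eq
        (show 2 ^ l ≤ X.card by rw [hXc, pow_succ]; omega)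
      have hX₁c : (X \ X₀).card = 2 ^ l := by
        rw [Finset.card_sdiff_of_subset hX₀, hXc, hX₀c, pow_succ]; omega
      obtain ⟨δ, hδ, hδX⟩ : ∃ δ ∈ H, δ ∉ X := by
        refine Finset.exists_mem_notMem_of_card_lt_card ?_
        rw [hXc, hcard]
        exact Nat.lt_succ_of_le (Nat.pow_le_pow_right (by norm_num) (by omega))
      -- by the induction hypothesis, the join over a half of `X` almost reaches `b`
      have hhalf : ∀ Y ⊆ X, Y.card = 2 ^ l →
          μ (A.theta (level a z Y k) b) ≤ DExt.emb _ (LSemi.gen k.bodd Y) := by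
        intro Y hY hYc
        have hYH := hY.trans hX
        have h : A.theta (level a z Y k) b ≤ A.theta (level a z Y k) (level a z Y (k + 1)) ⊔
            A.theta (level a z Y (k + 1)) b :=
          theta_le_iff.2 (Setoid.trans' _ (theta_le_iff.1 le_sup_left)
            (theta_le_iff.1 le_sup_right))
        refine (map_mono_of_sup μ h).trans (map_sup_le μ ?_ ?_)
        · refine map_theta_level_le hA μ a z k Y fun ξ hξ => ?_
          exact (hμ ξ (hHU (hYH hξ)) k (by omega)).trans
            (DExt.emb_le_emb.2 (LSemi.gen_mono _ (Finset.singleton_subset_iff.2 hξ)))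
        · rw [ih (k + 1) (by omega) Y hYH hYc]
          exact bot_le
      have herosion : ∀ Y ⊆ X, Y.card = 2 ^ l → ∀ β,
          μ (erosion A n (z δ) (level a z Y k) β) ≤ DExt.emb _ (LSemi.gen β {δ}) ∧
          μ (erosion A n (z δ) (level a z Y k) β) ≤ DExt.emb _ (LSemi.gen k.bodd Y) := by
        intro Y hY hYc β
        refine ⟨map_erosion_le hA μ _ fun i hi hβ => hβ ▸ hμ δ (hHU hδ) i hi, ?_⟩
        exact (map_mono_of_sup μ (erosion_le_theta hA (hlevel Y (hY.trans hX) k)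
          (hzb δ (hHU hδ)) β)).trans (hhalf Y hY hYc)
      have hX₁ : X \ X₀ ⊆ X := Finset.sdiff_subset
      obtain ⟨h₁, h₂⟩ := herosion X₀ hX₀ hX₀c false
      obtain ⟨h₃, h₄⟩ := herosion (X \ X₀) hX₁ hX₁c true
      refine GSemi.eq_bot_of_le_sup (fun h => hδX (hX₀ h)) (fun h => hδX (hX₁ h))
        (hsupp₂ X₀ (hX₀.trans hX) (X \ X₀) (hX₁.trans hX) Finset.disjoint_sdiff k (by omega) δ hδ
          (fun h => hδX (hX₁ h)) false) h₁ h₂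
        (hsupp₂ (X \ X₀) (hX₁.trans hX) X₀ (hX₀.trans hX) Finset.sdiff_disjoint k (by omega) δ hδ
          (fun h => hδX (hX₀ h)) true) h₃ h₄ (hsupp₁ X hX k (by omega) δ hδ hδX) ?_
      have hunion : level a z X k = level a z X₀ k ⊔ level a z (X \ X₀) k := by
        rw [← level_union, Finset.union_sdiff_of_subset hX₀]
      have h := theta_le_erosion_sup hA n (z δ) (level a z X₀ k) (level a z (X \ X₀) k)
      rw [← hunion, hz0 δ (hHU hδ), hzn δ (hHU hδ), sup_eq_right.2 (level_le_iff.1 le_rfl).1,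
        sup_eq_left.2 (hlevel X hX k)] at h
      exact (map_mono_of_sup μ h).trans (map_sup_le μ le_sup_left le_sup_right)
  obtain ⟨X, hX, hXc⟩ := Finset.exists_subset_card_eq (show 2 ^ n ≤ H.card by omega)
  have ha : level a z X 0 = a := le_antisymm
    (level_le_iff.2 ⟨le_rfl, fun ξ hξ => (hz0 ξ (hHU (hX hξ))).le⟩) (level_le_iff.1 le_rfl).1
  simpa [ha] using key n 0 rfl X hX hXc

end
end CLP

theorem theorem7p1 {Ω : Type*}
    (hΩ : Cardinal.aleph (Ordinal.omega0 + 1) ≤ Cardinal.mk Ω)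
    {L : Type*} [Nonempty L] (A : CLP.AlgStr L)
    [Lattice L] (hA : A.CongruenceCompatibleLattice) :
    ¬ ∃ μ : SupBotHom A.Conc (CLP.GSemi Ω),
      CLP.WeaklyDistributive μ ∧ (⊤ : CLP.GSemi Ω) ∈ Set.range μ := by
  rintro ⟨μ, hμ, θ, hθ⟩
  obtain ⟨a, b, hab, hle⟩ := hA.exists_le_theta θ
  have htop : μ (A.theta a b) = ⊤ :=
    top_le_iff.1 (hθ.symm.le.trans (CLP.map_mono_of_sup μ hle))
  have hchain : ∀ ξ : Ω, ∃ (n : ℕ) (z : ℕ → L), z 0 = a ∧ z n = b ∧ (∀ i, z i ≤ b) ∧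
      ∀ i < n, μ (A.theta (z i) (z (i + 1))) ≤ CLP.DExt.emb _ (CLP.LSemi.gen i.bodd {ξ}) := by
    intro ξ
    obtain ⟨x, y, hxy, hx, hy⟩ := hμ (A.theta a b) (CLP.DExt.emb _ (CLP.LSemi.gen false {ξ}))
      (CLP.DExt.emb _ (CLP.LSemi.gen true {ξ})) (by
        refine le_top.trans (le_of_eq ?_)
        refine Eq.trans ?_ (CLP.DExt.mk_sup 0 _ _)
        exact congrArg (CLP.DExt.emb _) (CLP.LSemi.gen_sup_gen ξ).symm)
    obtain ⟨n, z, hz0, hzn, hzb, hz⟩ := hA.exists_chain hab (fun β => bif β then y else x) hxy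
    refine ⟨n, z, hz0, hzn, hzb, fun i hi => ?_⟩
    refine (CLP.map_mono_of_sup μ (CLP.AlgStr.theta_le_iff.2 (hz i hi))).trans ?_
    cases i.bodd
    · exact hx
    · exact hy
  choose N z hz0 hzn hzb hz using hchain
  obtain ⟨n, hn⟩ := CLP.exists_large_fiber hΩ N
  have hbot : μ (A.theta a b) = ⊥ :=
    CLP.map_theta_eq_bot hA μ hab n (N ⁻¹' {n}) hn z (fun ξ _ => hz0 ξ)
      (fun ξ hξ => by obtain rfl : N ξ = n := hξ; exact hzn ξ) (fun ξ _ => hzb ξ)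
      (fun ξ hξ => by obtain rfl : N ξ = n := hξ; exact hz ξ)
  rw [htop] at hbot
  have h : (⊤ : CLP.LSemi Ω) ≤ ⊥ :=
    CLP.DExt.emb_le_emb.1 (show CLP.DExt.emb _ ⊤ ≤ CLP.DExt.emb _ ⊥ from hbot.le)
  exact WithTop.not_top_le_coe (⊥ : CLP.DisjPair Ω) h
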